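/- Let $F$ be a field of characteristic zero, $x\in F$ with $x\neq 0$, and $n\ge 0$ an integer. A \emph{diagram} is a graph on $2n$ vertices (top vertices $1,\dots,n$ and bottom vertices $1',\dots,n'$) in which every vertex has degree at most one. Arcs inside one row are called horizontal, arcs between the rows vertical. For diagrams $\mathfrak a,\mathfrak b$ let $G(\mathfrak a,\mathfrak b)$ be the graph obtained by placing $\mathfrak a$ above $\mathfrak b$ and joining the $i$-th bottom vertex of $\mathfrak a$ to the $i$-th top vertex of $\mathfrak b$ for all $i$; let $\ell(\mathfrak a,\mathfrak b)$ be the number of its components that contain no top vertex of $\mathfrak a$ and no bottom vertex of $\mathfrak b$, and let $G'(\mathfrak a,\mathfrak b)$ be the diagram on the top vertices of $\mathfrak a$ and the bottom vertices of $\mathfrak b$ in which two distinct vertices are joined if and only if they are connected in $G(\mathfrak a,\mathfrak b)$. Let $\mathbb A_n$ be the $F$-algebra with basis the set of all diagrams and multiplication $\mathfrak a\mathfrak b=x^{\ell(\mathfrak a,\mathfrak b)}G'(\mathfrak a,\mathfrak b)$, and let $\mathbb L_n$ be the subalgebra spanned by the diagrams without horizontal arcs. Let $\mathbb X_n\in\{\mathbb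 A_n,\mathbb L_n\}$. For $0\le m\le n$ let $\mathbb X_n^m$ be the two-sided ideal of $\mathbb X_n$ generated by its diagrams with at most $m$ vertical arcs ($\mathbb X_n^{-1}=0$), and put $\mathbb I_n^m=\mathbb X_n^m/\mathbb X_n^{m-1}$. Let $\lambda$ be a partition of $m=n-t$, where $0\le t\le n$, let $S^\lambda$ be its Specht module over $F$, let $\mathfrak u_{n,t}$ be the diagram with vertical arcs $(i,i')$ for $i\le n-t$ and no other arcs, and let $S_{n-t}$ act on the right of $\mathbb I_n^{n-t}\mathfrak u_{n,t}$ through permutation diagrams acting on the first $n-t$ vertices. Define the left $\mathbb X_n$-modules $$M(\lambda)=\mathbb I_n^{n-t}\mathfrak u_{n,t}\otimes_{S_{n-t}}S^\lambda,\qquad N(\lambda)=\{w\in M(\lambda)\mid \mathbb I_n^{n-t}w=0\},$$ with the action $\mathfrak b\cdot(\mathfrak a\otimes v)=(\mathfrak b\mathfrak a)\otimes v$. Then: (a) For every such $\lambda$, $M(\lambda)/N(\lambda)$ is irreducible as an $\mathbb X_n$-module and as an $\mathbb I_n^{n-t}$-module (that is, $\mathbb I_n^{n-t}$ acts on it nontrivially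 and its only invariant subspaces are $0$ and itself). In particular, $M(\lambda)$ is an irreducible $\mathbb X_n$-module if and only if $N(\lambda)=0$. (b) For every such $\lambda$, $N(\lambda)$ is a maximal $\mathbb X_n$-submodule of $M(\lambda)$, and it is the only maximal $\mathbb X_n$-submodule of $M(\lambda)$. (c) For every irreducible $\mathbb X_n$-module $V$ there exist $m\le n$ and a partition $\lambda$ of $m$ such that $V\cong M(\lambda)/N(\lambda)$ as $\mathbb X_n$-modules. -/

import Mathlib

namespace LoopBrauer

/-! ### Graphs with marked vertices -/

section Graphs

variable {W O : Type*}

/-- The graph on the marked vertices `o v` of `H`: two distinct marked vertices are joined by an edge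
if and only if they are connected by a path of `H`. -/
def joinGraph (H : SimpleGraph W) (o : O → W) : SimpleGraph O where
  Adj u v := u ≠ v ∧ H.Reachable (o u) (o v)
  symm := ⟨fun _ _ h => ⟨h.1.symm, h.2.symm⟩⟩
  loopless := ⟨fun _ h => h.1 rfl⟩

/-- The number of connected components of `H` that contain no marked vertex. -/
noncomputable def innerCount (H : SimpleGraph W) (o : O → W) : ℕ :=
  Nat.card {C : H.ConnectedComponent // ∀ v, H.connectedComponentMk (o v) ≠ C}

/-- In a graph of maximal degree two, a path ending in a vertex of degree at most one is determined
by its first edge. -/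
theorem path_end_unique {H : SimpleGraph W} {o : O → W}
    (hout : ∀ s u v, H.Adj (o s) u → H.Adj (o s) v → u = v)
    (htwo : ∀ w u₁ u₂ u₃, H.Adj w u₁ → H.Adj w u₂ → H.Adj w u₃ →
      u₁ = u₂ ∨ u₁ = u₃ ∨ u₂ = u₃)
    {v w : W} (p : H.Walk v w) : ∀ (u z : W) (q : H.Walk v z) (s t : O), H.Adj u v →
      p.IsPath → q.IsPath → u ∉ p.support → u ∉ q.support → w = o s → z = o t → w = z := by
  induction p with
  | nil =>
    intro u z q s t huv _ hq _ huq hs ht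
    cases q with
    | nil => rfl
    | cons h q' =>
      subst hs
      have := hout s _ _ huv.symm h
      subst this
      simp at huq
  | cons h p' ih =>
    intro u z q s t huv hp hq hup huq hs ht
    cases q with
    | nil =>
      subst ht
      have := hout t _ _ huv.symm h
      subst this
      simp at hup
    | cons h' q' =>
      rw [SimpleGraph.Walk.cons_isPath_iff] at hp hq
      rcases htwo _ _ _ _ huv.symm h h' with e | e | e
      · subst e; simp at hup
      · subst e; simp at huq
      · subst e
        exact ih _ _ q' s t h hp.1 hq.1 hp.2 hq.2 hs ht

theorem joinGraph_matching {H : SimpleGraph W} {o : O → W} (ho : Function.Injective o)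
    (hout : ∀ s u v, H.Adj (o s) u → H.Adj (o s) v → u = v)
    (htwo : ∀ w u₁ u₂ u₃, H.Adj w u₁ → H.Adj w u₂ → H.Adj w u₃ →
      u₁ = u₂ ∨ u₁ = u₃ ∨ u₂ = u₃)
    {u v w : O} (h₁ : (joinGraph H o).Adj u v) (h₂ : (joinGraph H o).Adj u w) : v = w := by
  obtain ⟨p, hp⟩ := h₁.2.exists_isPath
  obtain ⟨q, hq⟩ := h₂.2.exists_isPath
  obtain ⟨a, h, p', rfl⟩ := SimpleGraph.Walk.exists_eq_cons_of_ne (fun e => h₁.1 (ho e)) p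
  obtain ⟨a', h', q', rfl⟩ := SimpleGraph.Walk.exists_eq_cons_of_ne (fun e => h₂.1 (ho e)) q
  rw [SimpleGraph.Walk.cons_isPath_iff] at hp hq
  have e := hout _ _ _ h h'
  subst e
  exact ho (path_end_unique hout htwo p' _ _ q' v w h hp.1 hq.1 hp.2 hq.2 rfl rfl)

theorem reach_of_step {V : Type*} {H : SimpleGraph W} {K : SimpleGraph V} (P : W → V → Prop)
    (hP : ∀ w p q, P w p → P w q → K.Reachable p q)
    (step : ∀ w w' p, H.Adj w w' → P w p → ∃ q, P w' q ∧ K.Reachable p q)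
    {w w' : W} (h : H.Reachable w w') {p q : V} (hp : P w p) (hq : P w' q) :
    K.Reachable p q := by
  obtain ⟨r⟩ := h
  induction r generalizing p with
  | nil => exact hP _ _ _ hp hq
  | cons a _ ih =>
    obtain ⟨p', hp', hr⟩ := step _ _ _ a hp
    exact hr.trans (ih hp' hq)

theorem reach_map {V : Type*} {H : SimpleGraph W} {K : SimpleGraph V} (f : W → V)
    (hf : ∀ w w', H.Adj w w' → K.Reachable (f w) (f w')) {w w' : W} (h : H.Reachable w w') :
    K.Reachable (f w) (f w') :=
  reach_of_step (fun w v => f w = v) (fun _ _ _ h₁ h₂ => by rw [← h₁, ← h₂])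
    (fun w w' p a h₁ => ⟨_, rfl, h₁ ▸ hf w w' a⟩) h rfl rfl

section Elim

variable {W₁ S Z : Type*} {H₁ : SimpleGraph W₁} {o₁ : S → W₁}
  {B : SimpleGraph (W₁ ⊕ Z)} {B' : SimpleGraph (S ⊕ Z)} {R : S ⊕ Z → S ⊕ Z → Prop}

theorem elim_up
    (hB : ∀ w w', B.Adj w w' ↔ (∃ u u', w = .inl u ∧ w' = .inl u' ∧ H₁.Adj u u') ∨
      ∃ p q, w = Sum.map o₁ id p ∧ w' = Sum.map o₁ id q ∧ R p q)
    (hB' : ∀ p q, B'.Adj p q ↔ (∃ u v, p = .inl u ∧ q = .inl v ∧ u ≠ v ∧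
      H₁.Reachable (o₁ u) (o₁ v)) ∨ R p q) {p q : S ⊕ Z} (h : B'.Reachable p q) :
    B.Reachable (Sum.map o₁ id p) (Sum.map o₁ id q) := by
  refine reach_map _ (fun p q a => ?_) h
  rcases (hB' _ _).1 a with ⟨u, v, rfl, rfl, -, r⟩ | r
  · exact reach_map (Sum.inl : W₁ → W₁ ⊕ Z)
      (fun w w' a => SimpleGraph.Adj.reachable ((hB _ _).2 (.inl ⟨_, _, rfl, rfl, a⟩))) r
  · exact SimpleGraph.Adj.reachable ((hB _ _).2 (.inr ⟨_, _, rfl, rfl, r⟩))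

theorem elim_down
    (hB : ∀ w w', B.Adj w w' ↔ (∃ u u', w = .inl u ∧ w' = .inl u' ∧ H₁.Adj u u') ∨
      ∃ p q, w = Sum.map o₁ id p ∧ w' = Sum.map o₁ id q ∧ R p q)
    (hB' : ∀ p q, B'.Adj p q ↔ (∃ u v, p = .inl u ∧ q = .inl v ∧ u ≠ v ∧
      H₁.Reachable (o₁ u) (o₁ v)) ∨ R p q) {p q : S ⊕ Z}
    (h : B.Reachable (Sum.map o₁ id p) (Sum.map o₁ id q)) : B'.Reachable p q := by
  have key : ∀ u v, H₁.Reachable (o₁ u) (o₁ v) → B'.Reachable (.inl u) (.inl v) := by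
    intro u v r
    by_cases e : u = v
    · rw [e]
    · exact SimpleGraph.Adj.reachable ((hB' _ _).2 (.inl ⟨_, _, rfl, rfl, e, r⟩))
  let P : W₁ ⊕ Z → S ⊕ Z → Prop := fun w p =>
    (∃ u s, w = .inl u ∧ p = .inl s ∧ H₁.Reachable (o₁ s) u) ∨ ∃ z, w = .inr z ∧ p = .inr z
  have hPf : ∀ p, P (Sum.map o₁ id p) p := by
    rintro (s | z)
    · exact .inl ⟨_, _, rfl, rfl, .refl _⟩
    · exact .inr ⟨z, rfl, rfl⟩
  have hP : ∀ w p q, P w p → P w q → B'.Reachable p q := by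
    rintro (w | w) p q
    · rintro (⟨u, s, h1, rfl, r⟩ | ⟨z, h1, rfl⟩) (⟨u', s', h2, rfl, r'⟩ | ⟨z', h2, rfl⟩) <;>
        cases h1 <;> cases h2
      exact key _ _ (r.trans r'.symm)
    · rintro (⟨u, s, h1, rfl, r⟩ | ⟨z, h1, rfl⟩) (⟨u', s', h2, rfl, r'⟩ | ⟨z', h2, rfl⟩) <;>
        cases h1 <;> cases h2
      rfl
  refine reach_of_step P hP ?_ h (hPf p) (hPf q)
  intro w w' p a hp
  rcases (hB _ _).1 a with ⟨u, u', rfl, rfl, a₁⟩ | ⟨p₁, q₁, rfl, rfl, r⟩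
  · rcases hp with ⟨u₁, s, h1, rfl, r⟩ | ⟨z, h1, rfl⟩ <;> cases h1
    exact ⟨_, .inl ⟨_, _, rfl, rfl, r.trans a₁.reachable⟩, .refl _⟩
  · exact ⟨q₁, hPf _, (hP _ _ _ hp (hPf p₁)).trans (SimpleGraph.Adj.reachable ((hB' _ _).2 (.inr r)))⟩

theorem elim_join
    (hB : ∀ w w', B.Adj w w' ↔ (∃ u u', w = .inl u ∧ w' = .inl u' ∧ H₁.Adj u u') ∨
      ∃ p q, w = Sum.map o₁ id p ∧ w' = Sum.map o₁ id q ∧ R p q)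
    (hB' : ∀ p q, B'.Adj p q ↔ (∃ u v, p = .inl u ∧ q = .inl v ∧ u ≠ v ∧
      H₁.Reachable (o₁ u) (o₁ v)) ∨ R p q) (o : O → S ⊕ Z) :
    joinGraph B (Sum.map o₁ id ∘ o) = joinGraph B' o := by
  ext u v
  exact and_congr_right fun _ => ⟨elim_down hB hB', elim_up hB hB'⟩

theorem elim_count [Finite W₁] [Finite S] [Finite Z]
    (hB : ∀ w w', B.Adj w w' ↔ (∃ u u', w = .inl u ∧ w' = .inl u' ∧ H₁.Adj u u') ∨
      ∃ p q, w = Sum.map o₁ id p ∧ w' = Sum.map o₁ id q ∧ R p q)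
    (hB' : ∀ p q, B'.Adj p q ↔ (∃ u v, p = .inl u ∧ q = .inl v ∧ u ≠ v ∧
      H₁.Reachable (o₁ u) (o₁ v)) ∨ R p q) (o : O → S ⊕ Z) :
    innerCount B (Sum.map o₁ id ∘ o) = innerCount H₁ o₁ + innerCount B' o := by
  -- a vertex of the left part that is not joined to the image of `o₁` stays in its component
  have stay : ∀ (u : W₁) (w : W₁ ⊕ Z), (∀ s, ¬ H₁.Reachable (o₁ s) u) →
      B.Reachable (.inl u) w → ∃ u', w = .inl u' ∧ H₁.Reachable u u' := by
    rintro u w hu ⟨r⟩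
    have gen : ∀ (x y : W₁ ⊕ Z), B.Walk x y → (∃ u', x = .inl u' ∧ H₁.Reachable u u') →
        ∃ u', y = .inl u' ∧ H₁.Reachable u u' := by
      intro x y r
      induction r with
      | nil => exact id
      | cons a _ ih =>
        rintro ⟨u', rfl, hr⟩
        apply ih
        rcases (hB _ _).1 a with ⟨v, v', h1, rfl, a⟩ | ⟨p, q, h1, rfl, -⟩
        · cases h1
          exact ⟨_, rfl, hr.trans a.reachable⟩
        · rcases p with s | z <;> cases h1
          exact absurd hr.symm (hu s)
    exact gen _ _ r ⟨u, rfl, .refl _⟩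
  have inlR : ∀ {u u' : W₁}, H₁.Reachable u u' → B.Reachable (.inl u) (.inl u') := fun r =>
    reach_map (Sum.inl : W₁ → W₁ ⊕ Z)
      (fun w w' a => SimpleGraph.Adj.reachable ((hB _ _).2 (.inl ⟨_, _, rfl, rfl, a⟩))) r
  have off : ∀ {u : W₁}, (∀ v, H₁.connectedComponentMk (o₁ v) ≠ H₁.connectedComponentMk u) →
      ∀ s, ¬ H₁.Reachable (o₁ s) u :=
    fun h s r => h s (SimpleGraph.ConnectedComponent.sound r)
  let φ : H₁.ConnectedComponent → B.ConnectedComponent :=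
    Quot.map Sum.inl (fun _ _ r => inlR r)
  let ψ : B'.ConnectedComponent → B.ConnectedComponent :=
    Quot.map (Sum.map o₁ id) (fun _ _ r => elim_up hB hB' r)
  have hφ : ∀ C : {C : H₁.ConnectedComponent // ∀ v, H₁.connectedComponentMk (o₁ v) ≠ C},
      ∀ v, B.connectedComponentMk ((Sum.map o₁ id ∘ o) v) ≠ φ C.1 := by
    rintro ⟨⟨u⟩, hu⟩ v e
    obtain ⟨u', e', r⟩ := stay u _ (off hu) (SimpleGraph.ConnectedComponent.exact e).symm
    simp only [Function.comp_apply] at e'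
    rcases h : o v with s | z <;> rw [h] at e' <;> cases e'
    exact off hu s r.symm
  have hψ : ∀ C : {C : B'.ConnectedComponent // ∀ v, B'.connectedComponentMk (o v) ≠ C},
      ∀ v, B.connectedComponentMk ((Sum.map o₁ id ∘ o) v) ≠ ψ C.1 := by
    rintro ⟨⟨p⟩, hp⟩ v e
    exact hp v (SimpleGraph.ConnectedComponent.sound
      (elim_down hB hB' (SimpleGraph.ConnectedComponent.exact e)))
  rw [innerCount, innerCount, innerCount, ← Nat.card_sum]
  refine (Nat.card_congr (Equiv.ofBijective
    (Sum.elim (fun C => ⟨φ C.1, hφ C⟩) (fun C => ⟨ψ C.1, hψ C⟩)) ⟨?_, ?_⟩)).symm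
  · rintro (⟨⟨u⟩, hu⟩ | ⟨⟨p⟩, hp⟩) (⟨⟨u'⟩, hu'⟩ | ⟨⟨p'⟩, hp'⟩) e <;>
      simp only [Sum.elim_inl, Sum.elim_inr, Subtype.mk.injEq] at e
    · obtain ⟨u₁, e₁, r⟩ := stay u _ (off hu) (SimpleGraph.ConnectedComponent.exact e)
      cases e₁
      exact congrArg Sum.inl (Subtype.ext (SimpleGraph.ConnectedComponent.sound r))
    · obtain ⟨u₁, e₁, r⟩ := stay u _ (off hu) (SimpleGraph.ConnectedComponent.exact e)
      rcases p' with s | z <;> cases e₁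
      exact absurd r.symm (off hu s)
    · obtain ⟨u₁, e₁, r⟩ := stay u' _ (off hu') (SimpleGraph.ConnectedComponent.exact e).symm
      rcases p with s | z <;> cases e₁
      exact absurd r.symm (off hu' s)
    · exact congrArg Sum.inr (Subtype.ext (SimpleGraph.ConnectedComponent.sound
        (elim_down hB hB' (SimpleGraph.ConnectedComponent.exact e))))
  · rintro ⟨⟨w⟩, hw⟩
    have fromB' : ∀ p : S ⊕ Z, B.Reachable (Sum.map o₁ id p) w → ∃ a, Sum.elim
        (fun C : {C : H₁.ConnectedComponent // ∀ v, H₁.connectedComponentMk (o₁ v) ≠ C} =>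
          (⟨φ C.1, hφ C⟩ : {C : B.ConnectedComponent //
            ∀ v, B.connectedComponentMk ((Sum.map o₁ id ∘ o) v) ≠ C}))
        (fun C : {C : B'.ConnectedComponent // ∀ v, B'.connectedComponentMk (o v) ≠ C} =>
          ⟨ψ C.1, hψ C⟩) a = ⟨Quot.mk _ w, hw⟩ := by
      intro p r
      refine ⟨.inr ⟨B'.connectedComponentMk p, fun v e => hw v ?_⟩,
        Subtype.ext (SimpleGraph.ConnectedComponent.sound r)⟩
      exact SimpleGraph.ConnectedComponent.sound
        ((elim_up hB hB' (SimpleGraph.ConnectedComponent.exact e)).trans r)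
    rcases w with u | z
    · by_cases hu : ∃ s, H₁.Reachable (o₁ s) u
      · obtain ⟨s, hs⟩ := hu
        exact fromB' (.inl s) (inlR hs)
      · exact ⟨.inl ⟨H₁.connectedComponentMk u, fun v e =>
          hu ⟨v, SimpleGraph.ConnectedComponent.exact e⟩⟩, rfl⟩
    · exact fromB' (.inr z) (.refl _)

end Elim

theorem joinGraph_iso {V : Type*} {H : SimpleGraph W} {K : SimpleGraph V} (e : H ≃g K)
    (o : O → W) : joinGraph K (e ∘ o) = joinGraph H o := by
  ext u v
  exact and_congr_right fun _ => e.reachable_iff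

theorem innerCount_iso {V : Type*} {H : SimpleGraph W} {K : SimpleGraph V} (e : H ≃g K)
    (o : O → W) : innerCount K (e ∘ o) = innerCount H o := by
  refine (Nat.card_congr (e.connectedComponentEquiv.subtypeEquiv fun C => ?_)).symm
  refine forall_congr' fun v => not_congr ?_
  rw [← e.connectedComponentEquiv.injective.eq_iff]
  rfl

end Graphs

/-! ### Diagrams -/

/-- A diagram: a graph on `n` top vertices `.inl i` and `n` bottom vertices `.inr i` in which every
vertex has degree at most one. The isolated vertices are the ones that carry a loop when the diagram
is drawn. -/
@[ext]
structure Diagram (n : ℕ) where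
  graph : SimpleGraph (Fin n ⊕ Fin n)
  matching : ∀ u v w, graph.Adj u v → graph.Adj u w → v = w

namespace Diagram

variable {n : ℕ}

instance : Finite (Diagram n) :=
  Finite.of_injective Diagram.graph fun _ _ h => Diagram.ext h

/-- Adjacency in the graph `G(a, b)`: the diagram `a` is placed above `b`, and the `i`-th bottom vertex
of `a` is joined to the `i`-th top vertex of `b`. -/
def stackAdj (a b : Diagram n) : (Fin n ⊕ Fin n) ⊕ (Fin n ⊕ Fin n) →
    (Fin n ⊕ Fin n) ⊕ (Fin n ⊕ Fin n) → Prop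
  | .inl u, .inl v => a.graph.Adj u v
  | .inr u, .inr v => b.graph.Adj u v
  | .inl (.inr i), .inr (.inl j) => i = j
  | .inr (.inl i), .inl (.inr j) => i = j
  | _, _ => False

/-- The graph `G(a, b)` on the vertices of `a` and of `b`. -/
def stack (a b : Diagram n) : SimpleGraph ((Fin n ⊕ Fin n) ⊕ (Fin n ⊕ Fin n)) where
  Adj := stackAdj a b
  symm := ⟨by
    rintro ((i | i) | (i | i)) ((j | j) | (j | j)) h <;> simp only [stackAdj] at h ⊢ <;>
      exact h.symm⟩
  loopless := ⟨by rintro ((i | i) | (i | i)) h <;> simp [stackAdj] at h⟩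

/-- The top vertices of `a` and the bottom vertices of `b` in `G(a, b)`. -/
def outer : Fin n ⊕ Fin n → (Fin n ⊕ Fin n) ⊕ (Fin n ⊕ Fin n)
  | .inl i => .inl (.inl i)
  | .inr i => .inr (.inr i)

theorem outer_injective : Function.Injective (outer (n := n)) := by
  rintro (i | i) (j | j) h <;> simp_all [outer]

/-- `ℓ(a, b)`: the number of components of `G(a, b)` containing neither a top vertex of `a` nor a
bottom vertex of `b`. -/
noncomputable def loops (a b : Diagram n) : ℕ := innerCount (stack a b) outer

/-- `G'(a, b)`: two outer vertices of `G(a, b)` are joined by an arc if and only if they are connected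
by a path of `G(a, b)`. -/
def comp (a b : Diagram n) : Diagram n where
  graph := joinGraph (stack a b) outer
  matching _ _ _ := joinGraph_matching outer_injective
    (by
      rintro (s | s) ((i | i) | (i | i)) ((j | j) | (j | j)) h₁ h₂ <;>
        simp only [outer, stack, stackAdj] at h₁ h₂
      all_goals first
        | exact congrArg Sum.inl (a.matching _ _ _ h₁ h₂)
        | exact congrArg Sum.inr (b.matching _ _ _ h₁ h₂))
    (by
      have hl : ∀ x u v, (stack a b).Adj (.inl x) (.inl u) → (stack a b).Adj (.inl x) (.inl v) →
          u = v := fun x u v h₁ h₂ => a.matching _ _ _ h₁ h₂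
      have hr : ∀ x u v, (stack a b).Adj (.inr x) (.inr u) → (stack a b).Adj (.inr x) (.inr v) →
          u = v := fun x u v h₁ h₂ => b.matching _ _ _ h₁ h₂
      have hlr : ∀ x u v, (stack a b).Adj (.inl x) (.inr u) → (stack a b).Adj (.inl x) (.inr v) →
          u = v := by
        rintro (x | x) (u | u) (v | v) h₁ h₂ <;> first
          | exact False.elim h₁
          | exact False.elim h₂
          | exact congrArg _ (Eq.trans (Eq.symm h₁) h₂)
      have hrl : ∀ x u v, (stack a b).Adj (.inr x) (.inl u) → (stack a b).Adj (.inr x) (.inl v) →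
          u = v := by
        rintro (x | x) (u | u) (v | v) h₁ h₂ <;> first
          | exact False.elim h₁
          | exact False.elim h₂
          | exact congrArg _ (Eq.trans (Eq.symm h₁) h₂)
      rintro (w | w) (u₁ | u₁) (u₂ | u₂) (u₃ | u₃) h₁ h₂ h₃
      · exact .inl (congrArg _ (hl _ _ _ h₁ h₂))
      · exact .inl (congrArg _ (hl _ _ _ h₁ h₂))
      · exact .inr (.inl (congrArg _ (hl _ _ _ h₁ h₃)))
      · exact .inr (.inr (congrArg _ (hlr _ _ _ h₂ h₃)))
      · exact .inr (.inr (congrArg _ (hl _ _ _ h₂ h₃)))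
      · exact .inr (.inl (congrArg _ (hlr _ _ _ h₁ h₃)))
      · exact .inl (congrArg _ (hlr _ _ _ h₁ h₂))
      · exact .inl (congrArg _ (hlr _ _ _ h₁ h₂))
      · exact .inl (congrArg _ (hrl _ _ _ h₁ h₂))
      · exact .inl (congrArg _ (hrl _ _ _ h₁ h₂))
      · exact .inr (.inl (congrArg _ (hrl _ _ _ h₁ h₃)))
      · exact .inr (.inr (congrArg _ (hr _ _ _ h₂ h₃)))
      · exact .inr (.inr (congrArg _ (hrl _ _ _ h₂ h₃)))
      · exact .inr (.inl (congrArg _ (hr _ _ _ h₁ h₃)))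
      · exact .inl (congrArg _ (hr _ _ _ h₁ h₂))
      · exact .inl (congrArg _ (hr _ _ _ h₁ h₂)))

/-- Adjacency in the graph of three stacked diagrams. -/
def stack₃Adj (a b c : Diagram n) :
    ((Fin n ⊕ Fin n) ⊕ (Fin n ⊕ Fin n)) ⊕ (Fin n ⊕ Fin n) →
    ((Fin n ⊕ Fin n) ⊕ (Fin n ⊕ Fin n)) ⊕ (Fin n ⊕ Fin n) → Prop
  | .inl u, .inl v => stackAdj a b u v
  | .inr u, .inr v => c.graph.Adj u v
  | .inl (.inr (.inr i)), .inr (.inl j) => i = j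
  | .inr (.inl i), .inl (.inr (.inr j)) => i = j
  | _, _ => False

/-- The graph of three stacked diagrams. -/
def stack₃ (a b c : Diagram n) :
    SimpleGraph (((Fin n ⊕ Fin n) ⊕ (Fin n ⊕ Fin n)) ⊕ (Fin n ⊕ Fin n)) where
  Adj := stack₃Adj a b c
  symm := ⟨by
    rintro (((i | i) | (i | i)) | (i | i)) (((j | j) | (j | j)) | (j | j)) h <;>
      simp only [stack₃Adj, stackAdj] at h ⊢ <;>
      exact h.symm⟩
  loopless := ⟨by rintro (((i | i) | (i | i)) | (i | i)) h <;> simp [stack₃Adj, stackAdj] at h⟩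

/-- The edges of `G(a, b)` that are not edges of `a`. -/
def sndAdj (c : Diagram n) : (Fin n ⊕ Fin n) ⊕ (Fin n ⊕ Fin n) →
    (Fin n ⊕ Fin n) ⊕ (Fin n ⊕ Fin n) → Prop
  | .inr u, .inr v => c.graph.Adj u v
  | .inl (.inr i), .inr (.inl j) => i = j
  | .inr (.inl i), .inl (.inr j) => i = j
  | _, _ => False

theorem left_B (a b c : Diagram n) (w w' : ((Fin n ⊕ Fin n) ⊕ (Fin n ⊕ Fin n)) ⊕ (Fin n ⊕ Fin n)) :
    (stack₃ a b c).Adj w w' ↔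
      (∃ u u', w = .inl u ∧ w' = .inl u' ∧ (stack a b).Adj u u') ∨
      ∃ p q, w = Sum.map outer id p ∧ w' = Sum.map outer id q ∧ sndAdj c p q := by
  change stack₃Adj a b c w w' ↔ (∃ u u', w = .inl u ∧ w' = .inl u' ∧ stackAdj a b u u') ∨ _
  rcases w with ((i | i) | (i | i)) | (i | i) <;> rcases w' with ((j | j) | (j | j)) | (j | j) <;>
    simp [stack₃Adj, stackAdj, outer, sndAdj]

theorem left_B' (a b c : Diagram n) (p q : (Fin n ⊕ Fin n) ⊕ (Fin n ⊕ Fin n)) :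
    (stack (comp a b) c).Adj p q ↔ (∃ u v, p = .inl u ∧ q = .inl v ∧ u ≠ v ∧
      (stack a b).Reachable (outer u) (outer v)) ∨ sndAdj c p q := by
  change stackAdj (comp a b) c p q ↔ _
  rcases p with (i | i) | (i | i) <;> rcases q with (j | j) | (j | j) <;>
    simp [stackAdj, sndAdj, comp, joinGraph]

/-- The mirror image of `sndAdj`, with the first diagram in the second summand. -/
def fstAdj (a : Diagram n) : (Fin n ⊕ Fin n) ⊕ (Fin n ⊕ Fin n) →
    (Fin n ⊕ Fin n) ⊕ (Fin n ⊕ Fin n) → Prop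
  | .inr u, .inr v => a.graph.Adj u v
  | .inl (.inl i), .inr (.inr j) => i = j
  | .inr (.inr i), .inl (.inl j) => i = j
  | _, _ => False

/-- The rotation `((a, b), c) ↦ ((b, c), a)` of the three layers. -/
def rot {A B C : Type*} : (A ⊕ B) ⊕ C ≃ (B ⊕ C) ⊕ A :=
  (Equiv.sumAssoc A B C).trans (Equiv.sumComm A (B ⊕ C))

theorem right_B (a b c : Diagram n) (w w' : ((Fin n ⊕ Fin n) ⊕ (Fin n ⊕ Fin n)) ⊕ (Fin n ⊕ Fin n)) :
    ((stack₃ a b c).map rot.toEmbedding).Adj w w' ↔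
      (∃ u u', w = .inl u ∧ w' = .inl u' ∧ (stack b c).Adj u u') ∨
      ∃ p q, w = Sum.map outer id p ∧ w' = Sum.map outer id q ∧ fstAdj a p q := by
  obtain ⟨w, rfl⟩ := rot.surjective w
  obtain ⟨w', rfl⟩ := rot.surjective w'
  rw [show rot w = rot.toEmbedding w from rfl, show rot w' = rot.toEmbedding w' from rfl,
    SimpleGraph.map_adj_apply]
  change stack₃Adj a b c w w' ↔
    (∃ u u', rot w = Sum.inl u ∧ rot w' = Sum.inl u' ∧ stackAdj b c u u') ∨
      ∃ p q, rot w = Sum.map outer id p ∧ rot w' = Sum.map outer id q ∧ fstAdj a p q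
  rcases w with ((i | i) | (i | i)) | (i | i) <;> rcases w' with ((j | j) | (j | j)) | (j | j) <;>
    simp [stack₃Adj, stackAdj, outer, fstAdj, rot]

theorem right_B' (a b c : Diagram n) (p q : (Fin n ⊕ Fin n) ⊕ (Fin n ⊕ Fin n)) :
    ((stack a (comp b c)).map (Equiv.sumComm _ _).toEmbedding).Adj p q ↔
      (∃ u v, p = .inl u ∧ q = .inl v ∧ u ≠ v ∧
      (stack b c).Reachable (outer u) (outer v)) ∨ fstAdj a p q := by
  obtain ⟨p, rfl⟩ := (Equiv.sumComm _ _).surjective p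
  obtain ⟨q, rfl⟩ := (Equiv.sumComm _ _).surjective q
  rw [show Equiv.sumComm _ _ p = (Equiv.sumComm _ _).toEmbedding p from rfl,
    show Equiv.sumComm _ _ q = (Equiv.sumComm _ _).toEmbedding q from rfl,
    SimpleGraph.map_adj_apply]
  change stackAdj a (comp b c) p q ↔ _
  rcases p with (i | i) | (i | i) <;> rcases q with (j | j) | (j | j) <;>
    simp [stackAdj, fstAdj, comp, joinGraph]

/-- The top row of the first and the bottom row of the third of three stacked diagrams. -/
def outer₃ (v : Fin n ⊕ Fin n) : ((Fin n ⊕ Fin n) ⊕ (Fin n ⊕ Fin n)) ⊕ (Fin n ⊕ Fin n) :=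
  Sum.map outer id (outer v)

theorem rot_outer₃ : (rot : _ ≃ _) ∘ outer₃ (n := n) =
    Sum.map outer id ∘ (Equiv.sumComm (Fin n ⊕ Fin n) (Fin n ⊕ Fin n) ∘ outer) := by
  funext v
  rcases v with v | v <;> rfl

theorem join_left (a b c : Diagram n) :
    joinGraph (stack₃ a b c) outer₃ = (comp (comp a b) c).graph :=
  elim_join (left_B a b c) (left_B' a b c) outer

theorem join_right (a b c : Diagram n) :
    joinGraph (stack₃ a b c) outer₃ = (comp a (comp b c)).graph := by
  have h := elim_join (right_B a b c) (right_B' a b c)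
    (Equiv.sumComm (Fin n ⊕ Fin n) (Fin n ⊕ Fin n) ∘ outer)
  rw [← rot_outer₃] at h
  exact (joinGraph_iso (SimpleGraph.Iso.map rot (stack₃ a b c)) outer₃).symm.trans
    (h.trans (joinGraph_iso (SimpleGraph.Iso.map (Equiv.sumComm _ _) (stack a (comp b c))) outer))

theorem count_left (a b c : Diagram n) :
    innerCount (stack₃ a b c) outer₃ = loops a b + loops (comp a b) c :=
  elim_count (left_B a b c) (left_B' a b c) outer

theorem count_right (a b c : Diagram n) :
    innerCount (stack₃ a b c) outer₃ = loops b c + loops a (comp b c) := by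
  have h := elim_count (right_B a b c) (right_B' a b c)
    (Equiv.sumComm (Fin n ⊕ Fin n) (Fin n ⊕ Fin n) ∘ outer)
  rw [← rot_outer₃] at h
  exact (innerCount_iso (SimpleGraph.Iso.map rot (stack₃ a b c)) outer₃).symm.trans
    (h.trans (congrArg _
      (innerCount_iso (SimpleGraph.Iso.map (Equiv.sumComm _ _) (stack a (comp b c))) outer)))

theorem comp_assoc (a b c : Diagram n) : comp (comp a b) c = comp a (comp b c) :=
  Diagram.ext ((join_left a b c).symm.trans (join_right a b c))

theorem loops_assoc (a b c : Diagram n) :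
    loops a b + loops (comp a b) c = loops b c + loops a (comp b c) :=
  (count_left a b c).symm.trans (count_right a b c)

/-- A retraction of a graph onto a graph with degrees at most one identifies the two joins. -/
theorem collapse {W V : Type*} {H : SimpleGraph W} {K : SimpleGraph V}
    (hK : ∀ u v w, K.Adj u v → K.Adj u w → v = w) {O : Type*} {o : O → W} (f : W → V) (g : V → W)
    (h₁ : ∀ w w', H.Adj w w' → f w = f w' ∨ K.Adj (f w) (f w'))
    (h₂ : ∀ w, H.Reachable w (g (f w))) (h₃ : ∀ v v', K.Adj v v' → H.Adj (g v) (g v'))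
    (hf : Function.Bijective (f ∘ o)) :
    joinGraph H o = K.comap (f ∘ o) ∧ innerCount H o = 0 := by
  constructor
  · ext s t
    constructor
    · rintro ⟨hne, hr⟩
      have hr' : K.Reachable (f (o s)) (f (o t)) := reach_map f (fun w w' a => by
        rcases h₁ w w' a with e | a
        · rw [e]
        · exact a.reachable) hr
      obtain ⟨p, hp⟩ := hr'.exists_isPath
      have hne' : f (o s) ≠ f (o t) := fun e => hne (hf.1 e)
      obtain ⟨v, a, p', rfl⟩ := SimpleGraph.Walk.exists_eq_cons_of_ne hne' p
      rw [SimpleGraph.Walk.cons_isPath_iff] at hp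
      by_cases e : v = f (o t)
      · subst e
        exact a
      · obtain ⟨v', a', p'', rfl⟩ := SimpleGraph.Walk.exists_eq_cons_of_ne e p'
        have := hK _ _ _ a.symm a'
        subst this
        simp at hp
    · intro a
      refine ⟨fun e => a.ne e, ?_⟩
      exact (h₂ _).trans ((h₃ _ _ a).reachable.trans (h₂ _).symm)
  · have : IsEmpty {C : H.ConnectedComponent // ∀ v, H.connectedComponentMk (o v) ≠ C} := by
      refine ⟨?_⟩
      rintro ⟨⟨w⟩, hw⟩
      obtain ⟨s, hs⟩ := hf.2 (f w)
      refine hw s (SimpleGraph.ConnectedComponent.sound ((h₂ _).trans ?_))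
      rw [show f (o s) = f w from hs]
      exact (h₂ w).symm
    exact Nat.card_of_isEmpty

/-- The diagram of a permutation, with the vertical arcs from the top vertex `σ i` to the bottom
vertex `i`; with this convention the diagram of `σ τ` is the product of those of `σ` and `τ`. -/
def ofPerm (σ : Equiv.Perm (Fin n)) : Diagram n where
  graph :=
    { Adj := fun u v => (∃ i, u = .inl (σ i) ∧ v = .inr i) ∨ ∃ i, u = .inr i ∧ v = .inl (σ i)
      symm := ⟨fun _ _ h => h.symm.imp (fun ⟨i, h₁, h₂⟩ => ⟨i, h₂, h₁⟩)
        (fun ⟨i, h₁, h₂⟩ => ⟨i, h₂, h₁⟩)⟩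
      loopless := ⟨by rintro u (⟨i, h₁, h₂⟩ | ⟨i, h₁, h₂⟩) <;> simp [h₁] at h₂⟩ }
  matching := by
    rintro u v w (⟨i, rfl, rfl⟩ | ⟨i, rfl, rfl⟩) (⟨j, h₁, rfl⟩ | ⟨j, h₁, rfl⟩) <;> simp_all

theorem ofPerm_comp (σ : Equiv.Perm (Fin n)) (a : Diagram n) :
    (comp (ofPerm σ) a).graph = a.graph.comap (Sum.map σ.symm id) ∧ loops (ofPerm σ) a = 0 := by
  let f : (Fin n ⊕ Fin n) ⊕ (Fin n ⊕ Fin n) → Fin n ⊕ Fin n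
    | .inl (.inl i) => .inl (σ.symm i)
    | .inl (.inr i) => .inl i
    | .inr v => v
  have hf : f ∘ outer = Sum.map σ.symm id := by
    funext v; rcases v with v | v <;> rfl
  have key := collapse (H := stack (ofPerm σ) a) a.matching (o := outer) f .inr ?_ ?_ ?_ ?_
  · rw [hf] at key; exact key
  · rintro ((i | i) | (i | i)) ((j | j) | (j | j)) h <;>
      simp only [stack, stackAdj, ofPerm] at h <;> first
      | exact .inr h
      | exact .inl (congrArg Sum.inl h)
      | grind
  · rintro ((i | i) | v)
    · have h₁ : (stack (ofPerm σ) a).Adj (.inl (.inl i)) (.inl (.inr (σ.symm i))) := by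
        simp [stack, stackAdj, ofPerm]
      have h₂ : (stack (ofPerm σ) a).Adj (.inl (.inr (σ.symm i))) (.inr (.inl (σ.symm i))) := by
        simp [stack, stackAdj]
      exact h₁.reachable.trans h₂.reachable
    · exact SimpleGraph.Adj.reachable (by simp [stack, stackAdj, f])
    · rfl
  · intro v w h
    exact h
  · rw [hf]
    exact (Equiv.sumCongr σ.symm (Equiv.refl _)).bijective

theorem comp_ofPerm (σ : Equiv.Perm (Fin n)) (a : Diagram n) :
    (comp a (ofPerm σ)).graph = a.graph.comap (Sum.map id σ) ∧ loops a (ofPerm σ) = 0 := by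
  let f : (Fin n ⊕ Fin n) ⊕ (Fin n ⊕ Fin n) → Fin n ⊕ Fin n
    | .inl v => v
    | .inr (.inl i) => .inr i
    | .inr (.inr i) => .inr (σ i)
  have hf : f ∘ outer = Sum.map id σ := by
    funext v; rcases v with v | v <;> rfl
  have key := collapse (H := stack a (ofPerm σ)) a.matching (o := outer) f .inl ?_ ?_ ?_ ?_
  · rw [hf] at key; exact key
  · rintro ((i | i) | (i | i)) ((j | j) | (j | j)) h <;>
      simp only [stack, stackAdj, ofPerm] at h <;> first
      | exact .inr h
      | exact .inl (congrArg Sum.inr h)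
      | grind
  · rintro (v | (i | i))
    · rfl
    · exact SimpleGraph.Adj.reachable (by simp [stack, stackAdj, f])
    · have h₁ : (stack a (ofPerm σ)).Adj (.inr (.inr i)) (.inr (.inl (σ i))) := by
        simp [stack, stackAdj, ofPerm]
      have h₂ : (stack a (ofPerm σ)).Adj (.inr (.inl (σ i))) (.inl (.inr (σ i))) := by
        simp [stack, stackAdj]
      exact h₁.reachable.trans h₂.reachable
  · intro v w h
    exact h
  · rw [hf]
    exact (Equiv.sumCongr (Equiv.refl _) σ).bijective

/-- The diagram has no horizontal arcs, i.e. no arc within the top row or within the bottom row. -/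
def NoHorizontal (d : Diagram n) : Prop :=
  ∀ i j, ¬ d.graph.Adj (.inl i) (.inl j) ∧ ¬ d.graph.Adj (.inr i) (.inr j)

theorem NoHorizontal.comp {a b : Diagram n} (ha : a.NoHorizontal) (hb : b.NoHorizontal) :
    (a.comp b).NoHorizontal := by
  have inv : ∀ (P : (Fin n ⊕ Fin n) ⊕ (Fin n ⊕ Fin n) → Prop),
      (∀ w w', (stack a b).Adj w w' → P w → P w') → ∀ w w', (stack a b).Reachable w w' →
      P w → P w' := by
    rintro P hP w w' ⟨r⟩
    induction r with
    | nil => exact id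
    | cons h _ ih => exact fun hp => ih (hP _ _ h hp)
  intro i j
  constructor
  · rintro ⟨hne, hr⟩
    refine hne (congrArg _ (Eq.symm (inv (fun w => match w with
      | .inl (.inl k) => k = i
      | .inl (.inr k) => a.graph.Adj (.inl i) (.inr k)
      | .inr (.inl k) => a.graph.Adj (.inl i) (.inr k)
      | .inr (.inr l) => ∃ k, a.graph.Adj (.inl i) (.inr k) ∧ b.graph.Adj (.inl k) (.inr l))
      ?_ _ _ hr rfl)))
    rintro ((k | k) | (k | k)) ((l | l) | (l | l)) h hp
    all_goals first
      | exact False.elim h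
      | exact ((ha _ _).1 h).elim
      | exact ((ha _ _).2 h).elim
      | exact ((hb _ _).1 h).elim
      | exact ((hb _ _).2 h).elim
      | skip
    · have hp : k = i := hp
      exact hp ▸ h
    · exact Sum.inl_injective (a.matching _ _ _ h (SimpleGraph.Adj.symm hp))
    · have h : k = l := h
      exact h ▸ hp
    · have h : k = l := h
      exact h ▸ hp
    · exact ⟨k, hp, h⟩
    · obtain ⟨k', h₁, h₂⟩ := hp
      have e := Sum.inl_injective (b.matching _ _ _ h h₂.symm)
      exact e ▸ h₁
  · rintro ⟨hne, hr⟩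
    refine hne (congrArg _ (Eq.symm (inv (fun w => match w with
      | .inr (.inr k) => k = i
      | .inr (.inl k) => b.graph.Adj (.inr i) (.inl k)
      | .inl (.inr k) => b.graph.Adj (.inr i) (.inl k)
      | .inl (.inl l) => ∃ k, b.graph.Adj (.inr i) (.inl k) ∧ a.graph.Adj (.inr k) (.inl l))
      ?_ _ _ hr rfl)))
    rintro ((k | k) | (k | k)) ((l | l) | (l | l)) h hp
    all_goals first
      | exact False.elim h
      | exact ((ha _ _).1 h).elim
      | exact ((ha _ _).2 h).elim
      | exact ((hb _ _).1 h).elim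
      | exact ((hb _ _).2 h).elim
      | skip
    · obtain ⟨k', h₁, h₂⟩ := hp
      have e := Sum.inr_injective (a.matching _ _ _ h h₂.symm)
      exact e ▸ h₁
    · exact ⟨k, hp, h⟩
    · have h : k = l := h
      exact h ▸ hp
    · have h : k = l := h
      exact h ▸ hp
    · exact Sum.inr_injective (b.matching _ _ _ h (SimpleGraph.Adj.symm hp))
    · have hp : k = i := hp
      exact hp ▸ h

theorem noHorizontal_ofPerm (σ : Equiv.Perm (Fin n)) : (ofPerm σ).NoHorizontal := by
  intro i j
  simp [ofPerm]

/-- The number of vertical arcs. -/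
noncomputable def verticals (d : Diagram n) : ℕ :=
  {i | ∃ j, d.graph.Adj (.inl i) (.inr j)}.ncard

/-- The diagram `𝔲_{n,t}` with `t = n - m`: straight verticals at the first `m` vertices of both rows,
and loops (isolated vertices) at the remaining `t` vertices of both rows. -/
def idem (n m : ℕ) : Diagram n where
  graph :=
    { Adj := fun u v => ∃ i : Fin n, (i : ℕ) < m ∧
        (u = .inl i ∧ v = .inr i ∨ u = .inr i ∧ v = .inl i)
      symm := ⟨fun _ _ ⟨i, hi, h⟩ => ⟨i, hi, h.symm.imp And.symm And.symm⟩⟩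
      loopless := ⟨by rintro u ⟨i, -, ⟨h₁, h₂⟩ | ⟨h₁, h₂⟩⟩ <;> simp [h₁] at h₂⟩ }
  matching := by
    rintro u v w ⟨i, -, ⟨rfl, rfl⟩ | ⟨rfl, rfl⟩⟩ ⟨j, -, ⟨h₁, rfl⟩ | ⟨h₁, rfl⟩⟩ <;> simp_all

theorem noHorizontal_idem (m : ℕ) : (idem n m).NoHorizontal := by
  intro i j
  simp [idem]

/-- The embedding of `S_m`, `m ≤ n`, into the diagrams: the permutation acts on the first `m` vertices
and fixes the remaining ones. -/
noncomputable def smallPerm {m : ℕ} (h : m ≤ n) (σ : Equiv.Perm (Fin m)) : Diagram n :=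
  ofPerm (σ.viaEmbedding (Fin.castLEEmb h))

theorem idem_comp_smallPerm {m : ℕ} (h : m ≤ n) (σ : Equiv.Perm (Fin m)) :
    comp (idem n m) (smallPerm h σ) = comp (smallPerm h σ) (idem n m) := by
  have hlt : ∀ i : Fin n, ((σ.viaEmbedding (Fin.castLEEmb h) i : Fin n) : ℕ) < m ↔ (i : ℕ) < m := by
    intro i
    by_cases hi : (i : ℕ) < m
    · have : i = Fin.castLEEmb h ⟨i, hi⟩ := rfl
      rw [this, Equiv.Perm.viaEmbedding_apply]
      simp [hi]
    · rw [Equiv.Perm.viaEmbedding_apply_of_notMem]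
      rintro ⟨k, rfl⟩
      exact hi k.2
  apply Diagram.ext
  rw [smallPerm, (comp_ofPerm _ _).1, (ofPerm_comp _ _).1]
  generalize σ.viaEmbedding (Fin.castLEEmb h) = τ at hlt
  ext (i | i) (j | j) <;> simp only [SimpleGraph.comap_adj, idem, Sum.map_inl, Sum.map_inr, id] <;>
    constructor <;> rintro ⟨k, hk, ⟨h₁, h₂⟩ | ⟨h₁, h₂⟩⟩ <;> cases h₁ <;> cases h₂
  · exact ⟨j, (hlt j).1 hk, .inl ⟨by simp, rfl⟩⟩
  · exact ⟨i, by simpa using (hlt (τ.symm i)).2 hk, .inl ⟨rfl, by simp⟩⟩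
  · exact ⟨i, (hlt i).1 hk, .inr ⟨rfl, by simp⟩⟩
  · exact ⟨j, by simpa using (hlt (τ.symm j)).2 hk, .inr ⟨by simp, rfl⟩⟩

theorem ofPerm_one_comp (a : Diagram n) : comp (ofPerm 1) a = a :=
  Diagram.ext ((ofPerm_comp 1 a).1.trans (by ext (u | u) (v | v) <;> rfl))

theorem comp_ofPerm_one (a : Diagram n) : comp a (ofPerm 1) = a :=
  Diagram.ext ((comp_ofPerm 1 a).1.trans (by ext (u | u) (v | v) <;> rfl))

end Diagram

/-! ### The algebras -/

/-- The algebra `𝔸_n(x)`: the vector space with basis the diagrams. -/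
def AAlg (F : Type*) [Field F] (n : ℕ) (_x : F) : Type _ := Diagram n →₀ F

namespace AAlg

variable {F : Type*} [Field F] {n : ℕ} {x : F}

noncomputable instance : AddCommGroup (AAlg F n x) := inferInstanceAs (AddCommGroup (Diagram n →₀ F))

noncomputable instance : Module F (AAlg F n x) := inferInstanceAs (Module F (Diagram n →₀ F))

variable (x) in
/-- The basis element given by a diagram. -/
noncomputable def of (d : Diagram n) : AAlg F n x := Finsupp.single d (1 : F)

variable (F n x) in
/-- The multiplication `a · b = x ^ ℓ(a, b) G'(a, b)`, extended bilinearly. -/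
noncomputable def mulₗ : AAlg F n x →ₗ[F] AAlg F n x →ₗ[F] AAlg F n x :=
  Finsupp.linearCombination F fun a : Diagram n =>
    (Finsupp.linearCombination F fun b : Diagram n =>
      x ^ a.loops b • of x (a.comp b) : AAlg F n x →ₗ[F] AAlg F n x)

theorem mulₗ_of (a b : Diagram n) :
    mulₗ F n x (of x a) (of x b) = x ^ a.loops b • of x (a.comp b) := by
  unfold mulₗ of
  erw [Finsupp.linearCombination_single, one_smul, Finsupp.linearCombination_single, one_smul]

theorem hom_ext {M : Type*} [AddCommMonoid M] [Module F M] {f g : AAlg F n x →ₗ[F] M}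
    (h : ∀ d, f (of x d) = g (of x d)) : f = g :=
  Finsupp.lhom_ext' fun d => LinearMap.ext_ring (h d)

theorem mulₗ_assoc (u v w : AAlg F n x) :
    mulₗ F n x (mulₗ F n x u v) w = mulₗ F n x u (mulₗ F n x v w) := by
  have h₁ : ∀ a b w, mulₗ F n x (mulₗ F n x (of x a) (of x b)) w =
      mulₗ F n x (of x a) (mulₗ F n x (of x b) w) := fun a b w => by
    have h : mulₗ F n x (mulₗ F n x (of x a) (of x b)) =
        mulₗ F n x (of x a) ∘ₗ mulₗ F n x (of x b) := hom_ext fun c => by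
      simp only [LinearMap.comp_apply, mulₗ_of, map_smul, LinearMap.smul_apply, smul_smul,
        ← pow_add, Diagram.comp_assoc, Diagram.loops_assoc, add_comm]
    exact LinearMap.congr_fun h w
  have h₂ : ∀ a v w, mulₗ F n x (mulₗ F n x (of x a) v) w =
      mulₗ F n x (of x a) (mulₗ F n x v w) := fun a v w => by
    have h : (mulₗ F n x).flip w ∘ₗ mulₗ F n x (of x a) =
        mulₗ F n x (of x a) ∘ₗ (mulₗ F n x).flip w := hom_ext fun b => h₁ a b w
    exact LinearMap.congr_fun h v
  have h : (mulₗ F n x).flip w ∘ₗ (mulₗ F n x).flip v =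
      (mulₗ F n x).flip (mulₗ F n x v w) := hom_ext fun a => h₂ a v w
  exact LinearMap.congr_fun h u

theorem one_mulₗ (u : AAlg F n x) : mulₗ F n x (of x (.ofPerm 1)) u = u := by
  have h : mulₗ F n x (of x (.ofPerm 1)) = LinearMap.id := hom_ext fun d => by
    rw [mulₗ_of, (Diagram.ofPerm_comp 1 d).2, Diagram.ofPerm_one_comp, pow_zero, one_smul]; rfl
  rw [h]; rfl

theorem mulₗ_one (u : AAlg F n x) : mulₗ F n x u (of x (.ofPerm 1)) = u := by
  have h : (mulₗ F n x).flip (of x (.ofPerm 1)) = LinearMap.id := hom_ext fun d => by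
    rw [LinearMap.flip_apply, mulₗ_of, (Diagram.comp_ofPerm 1 d).2, Diagram.comp_ofPerm_one,
      pow_zero, one_smul]; rfl
  exact LinearMap.congr_fun h u

noncomputable instance : Ring (AAlg F n x) :=
  { (inferInstance : AddCommGroup (AAlg F n x)) with
    mul := fun u v => mulₗ F n x u v
    one := of x (.ofPerm 1)
    mul_assoc := mulₗ_assoc
    one_mul := one_mulₗ
    mul_one := mulₗ_one
    left_distrib := fun u v w => map_add _ _ _
    right_distrib := fun u v w => LinearMap.map_add₂ _ _ _ _
    zero_mul := fun u => LinearMap.map_zero₂ _ _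
    mul_zero := fun u => map_zero _ }

noncomputable instance : Algebra F (AAlg F n x) :=
  Algebra.ofModule (fun _ _ _ => LinearMap.map_smul₂ _ _ _ _) (fun _ _ _ => map_smul _ _ _)

theorem of_mul_of (a b : Diagram n) : of x a * of x b = x ^ a.loops b • of x (a.comp b) :=
  mulₗ_of a b

end AAlg

/-- The names of the two families of algebras, `𝔸_n` and `𝕃_n`. -/
inductive Kind
  | A
  | L

/-- The diagrams spanning `𝕏_n`: all of them for `𝔸_n`, those without horizontal arcs for `𝕃_n`. -/
def Kind.diagrams (k : Kind) (n : ℕ) : Set (Diagram n) :=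
  match k with
  | .A => Set.univ
  | .L => {d | d.NoHorizontal}

theorem Kind.noHorizontal_mem (k : Kind) {n : ℕ} {d : Diagram n} (h : d.NoHorizontal) :
    d ∈ k.diagrams n := by
  cases k
  · exact Set.mem_univ _
  · exact h

theorem Kind.comp_mem (k : Kind) {n : ℕ} {a b : Diagram n} (ha : a ∈ k.diagrams n)
    (hb : b ∈ k.diagrams n) : a.comp b ∈ k.diagrams n := by
  cases k
  · exact Set.mem_univ _
  · exact Diagram.NoHorizontal.comp ha hb

section XAlg

variable (F : Type*) [Field F] (k : Kind) (n : ℕ) (x : F)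

theorem span_mul_mem {u v : AAlg F n x}
    (hu : u ∈ Submodule.span F (AAlg.of x '' k.diagrams n))
    (hv : v ∈ Submodule.span F (AAlg.of x '' k.diagrams n)) :
    u * v ∈ Submodule.span F (AAlg.of x '' k.diagrams n) := by
  have := Submodule.mul_mem_mul hu hv
  rw [Submodule.span_mul_span] at this
  refine Submodule.span_le.2 ?_ this
  rintro _ ⟨_, ⟨a, ha, rfl⟩, _, ⟨b, hb, rfl⟩, rfl⟩
  simp only [AAlg.of_mul_of]
  exact Submodule.smul_mem _ _ (Submodule.subset_span ⟨_, k.comp_mem ha hb, rfl⟩)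

/-- The subalgebra `𝕏_n(x)` of `𝔸_n(x)`, the span of the diagrams of the given kind. -/
noncomputable def xSubalgebra : Subalgebra F (AAlg F n x) :=
  Submodule.toSubalgebra (Submodule.span F (AAlg.of x '' k.diagrams n))
    (Submodule.subset_span ⟨_, k.noHorizontal_mem (Diagram.noHorizontal_ofPerm 1), rfl⟩)
    (fun _ _ => span_mul_mem F k n x)

/-- The algebra `𝕏_n(x)`: for `k = .A` it is `𝔸_n(x)`, for `k = .L` it is `𝕃_n(x)`. -/
def XAlg : Type _ := xSubalgebra F k n x

noncomputable instance : Ring (XAlg F k n x) := inferInstanceAs (Ring (xSubalgebra F k n x))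

noncomputable instance : Algebra F (XAlg F k n x) :=
  inferInstanceAs (Algebra F (xSubalgebra F k n x))

variable {k n} in
/-- A diagram of the right kind as an element of `𝕏_n(x)`. -/
noncomputable def XAlg.of (d : Diagram n) (hd : d ∈ k.diagrams n) : XAlg F k n x :=
  ⟨AAlg.of x d, Submodule.subset_span ⟨d, hd, rfl⟩⟩

/-- The two-sided ideal of `𝕏_n` generated by the diagrams with fewer than `m` vertical arcs. In the
filtration by the ideals `𝕏_n^m` generated by the diagrams with at most `m` vertical arcs,
`below (m + 1)` is `𝕏_n^m` and `below m` is `𝕏_n^{m-1}` (which is zero for `m = 0`). -/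
noncomputable def below (m : ℕ) : TwoSidedIdeal (XAlg F k n x) :=
  TwoSidedIdeal.span {y | ∃ (d : Diagram n) (hd : d ∈ k.diagrams n),
    d.verticals < m ∧ y = XAlg.of F x d hd}

end XAlg

open scoped TensorProduct

/-! ### Specht modules -/

section Specht

variable (F : Type*) [Field F] (μ : YoungDiagram)

/-- A Young tableau of shape `μ`: a bijection of the cells with the numbers. -/
abbrev Tableau : Type := {c // c ∈ μ.cells} ≃ Fin μ.card

/-- The permutations of the cells that preserve every column. -/
def columnGroup : Subgroup (Equiv.Perm {c // c ∈ μ.cells}) where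
  carrier := {π | ∀ c, (π c).1.2 = c.1.2}
  mul_mem' := fun {a b} ha hb c => (ha (b c)).trans (hb c)
  one_mem' := fun _ => rfl
  inv_mem' := fun {a} ha c => by
    have := ha (a⁻¹ c)
    rw [← Equiv.Perm.mul_apply, mul_inv_cancel, Equiv.Perm.one_apply] at this
    exact this.symm

open Classical in
/-- The polytabloid of `T`, the signed sum over the column group of the tabloids of the permuted
tableaux. A tabloid is recorded as the function sending each entry to the index of its row. -/
noncomputable def polytabloid (T : Tableau μ) : (Fin μ.card → ℕ) →₀ F :=
  ∑ π : columnGroup μ, Finsupp.single (fun e => (π.1 (T.symm e)).1.1)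
    ((Equiv.Perm.sign π.1 : ℤ) : F)

/-- The span of all polytabloids of shape `μ`. -/
noncomputable def spechtSubmodule : Submodule F ((Fin μ.card → ℕ) →₀ F) :=
  Submodule.span F (Set.range (polytabloid F μ))

/-- The symmetric group acts on tabloids by permuting the entries. -/
noncomputable def tabloidRep :
    Representation F (Equiv.Perm (Fin μ.card)) ((Fin μ.card → ℕ) →₀ F) where
  toFun σ := Finsupp.lmapDomain F F fun t e => t (σ⁻¹ e)
  map_one' := by ext; simp
  map_mul' σ τ := by ext; simp 

variable {F μ} in
theorem tabloidRep_polytabloid (σ : Equiv.Perm (Fin μ.card)) (T : Tableau μ) :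
    tabloidRep F μ σ (polytabloid F μ T) = polytabloid F μ (T.trans σ) := by
  simp only [polytabloid, map_sum]
  refine Finset.sum_congr rfl fun π _ => ?_
  exact Finsupp.mapDomain_single

variable {F μ} in
theorem tabloidRep_mem (σ : Equiv.Perm (Fin μ.card)) {v : (Fin μ.card → ℕ) →₀ F}
    (hv : v ∈ spechtSubmodule F μ) : tabloidRep F μ σ v ∈ spechtSubmodule F μ := by
  have : spechtSubmodule F μ ≤ (spechtSubmodule F μ).comap (tabloidRep F μ σ) := by
    refine Submodule.span_le.2 ?_
    rintro _ ⟨T, rfl⟩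
    exact Submodule.subset_span ⟨T.trans σ, (tabloidRep_polytabloid σ T).symm⟩
  exact this hv

/-- The Specht module `S^μ`. -/
def Specht : Type _ := spechtSubmodule F μ

noncomputable instance : AddCommGroup (Specht F μ) :=
  inferInstanceAs (AddCommGroup (spechtSubmodule F μ))

noncomputable instance : Module F (Specht F μ) := inferInstanceAs (Module F (spechtSubmodule F μ))

/-- The action of the symmetric group on the Specht module `S^μ`. -/
noncomputable def spechtRep : Representation F (Equiv.Perm (Fin μ.card)) (Specht F μ) where
  toFun σ := ((tabloidRep F μ σ).restrict fun _ => tabloidRep_mem σ :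
    spechtSubmodule F μ →ₗ[F] spechtSubmodule F μ)
  map_one' := by
    refine LinearMap.ext fun v => Subtype.ext ?_
    exact congrArg (fun f => f v.1) (map_one (tabloidRep F μ))
  map_mul' σ τ := by
    refine LinearMap.ext fun v => Subtype.ext ?_
    exact congrArg (fun f => f v.1) (map_mul (tabloidRep F μ) σ τ)

end Specht

/-! ### Modules over a layer `hi / lo` of an algebra -/

section Layers

variable {F X G V : Type*} [Field F] [Ring X] [Algebra F X] [Group G] [AddCommGroup V] [Module F V]

/-- The quotient algebra by a two-sided ideal `lo`. -/
def LayerRing (lo : TwoSidedIdeal X) : Type _ := X ⧸ lo.asIdeal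

variable (lo hi : TwoSidedIdeal X)

instance : Ring (LayerRing lo) := inferInstanceAs (Ring (X ⧸ lo.asIdeal))

instance : Algebra F (LayerRing lo) := inferInstanceAs (Algebra F (X ⧸ lo.asIdeal))

instance : Module X (LayerRing lo) := inferInstanceAs (Module X (X ⧸ lo.asIdeal))

instance : IsScalarTower X (LayerRing lo) (LayerRing lo) :=
  inferInstanceAs (IsScalarTower X (X ⧸ lo.asIdeal) (X ⧸ lo.asIdeal))

instance : IsScalarTower F X (LayerRing lo) :=
  inferInstanceAs (IsScalarTower F X (X ⧸ lo.asIdeal))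

/-- The quotient map. -/
def LayerRing.mk : X →+* LayerRing lo := Ideal.Quotient.mk lo.asIdeal

theorem LayerRing.mk_surjective : Function.Surjective (LayerRing.mk lo) :=
  Ideal.Quotient.mk_surjective

theorem LayerRing.smul_def (y : X) (r : LayerRing lo) : y • r = LayerRing.mk lo y * r := by
  obtain ⟨r, rfl⟩ := LayerRing.mk_surjective lo r
  rfl

/-- The image of the two-sided ideal `hi` in the quotient by `lo`; for `lo ≤ hi` this is the
algebra `hi / lo`. -/
def layer : Ideal (LayerRing lo) := hi.asIdeal.map (LayerRing.mk lo)

variable {lo hi} in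
theorem layer_mul_mem {r : LayerRing lo} (hr : r ∈ layer lo hi) (s : LayerRing lo) :
    r * s ∈ layer lo hi := by
  rw [layer, Ideal.mem_map_iff_of_surjective _ (LayerRing.mk_surjective lo)] at hr ⊢
  obtain ⟨y, hy, rfl⟩ := hr
  obtain ⟨z, rfl⟩ := LayerRing.mk_surjective lo s
  exact ⟨y * z, TwoSidedIdeal.mul_mem_right _ _ _ hy, map_mul _ _ _⟩

/-- The left ideal `{r u | r ∈ hi / lo}`. -/
def layerMul (u : X) : Ideal (LayerRing lo) :=
  Submodule.map
    (LinearMap.toSpanSingleton (LayerRing lo) (LayerRing lo) (LayerRing.mk lo u)) (layer lo hi)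

variable {u : X} {e : G → X} (he : ∀ g, u * e g = e g * u)

variable {lo hi} in
/-- The right action of `g` on `(hi / lo) u`, that is `p ↦ p (e g)`. -/
def layerRight (he : ∀ g, u * e g = e g * u) (g : G) :
    layerMul lo hi u →ₗ[LayerRing lo] layerMul lo hi u :=
  (LinearMap.toSpanSingleton (LayerRing lo) (LayerRing lo) (LayerRing.mk lo (e g))).restrict (by
    intro p hp
    obtain ⟨r, hr, rfl⟩ := Submodule.mem_map.1 hp
    refine Submodule.mem_map.2 ⟨r * LayerRing.mk lo (e g), layer_mul_mem hr _, ?_⟩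
    simp only [LinearMap.toSpanSingleton_apply, smul_eq_mul]
    rw [mul_assoc, mul_assoc, ← map_mul, ← map_mul, he g])

variable (ρ : Representation F G V)

/-- The relations `p g ⊗ v = p ⊗ g v` of the tensor product over the group. (They are stable under left
multiplication, so their span over the ring is their span over the field.) -/
def balancing : Submodule (LayerRing lo) (layerMul lo hi u ⊗[F] V) :=
  Submodule.span _ {z | ∃ p g v, z = layerRight he g p ⊗ₜ[F] v - p ⊗ₜ[F] ρ g v}

/-- The left module `(hi / lo) u ⊗_G V`. -/
def LayerModule : Type _ := (layerMul lo hi u ⊗[F] V) ⧸ balancing lo hi he ρ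

instance : AddCommGroup (LayerModule lo hi he ρ) :=
  inferInstanceAs (AddCommGroup ((layerMul lo hi u ⊗[F] V) ⧸ balancing lo hi he ρ))

instance : Module (LayerRing lo) (LayerModule lo hi he ρ) :=
  inferInstanceAs (Module (LayerRing lo) ((layerMul lo hi u ⊗[F] V) ⧸ balancing lo hi he ρ))

instance : Module X (LayerModule lo hi he ρ) :=
  inferInstanceAs (Module X ((layerMul lo hi u ⊗[F] V) ⧸ balancing lo hi he ρ))

instance : Module F (LayerModule lo hi he ρ) :=
  inferInstanceAs (Module F ((layerMul lo hi u ⊗[F] V) ⧸ balancing lo hi he ρ))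

instance : IsScalarTower X (LayerRing lo) (LayerModule lo hi he ρ) :=
  inferInstanceAs (IsScalarTower X (LayerRing lo)
    ((layerMul lo hi u ⊗[F] V) ⧸ balancing lo hi he ρ))

instance : IsScalarTower F (LayerRing lo) (LayerModule lo hi he ρ) :=
  inferInstanceAs (IsScalarTower F (LayerRing lo)
    ((layerMul lo hi u ⊗[F] V) ⧸ balancing lo hi he ρ))

instance : IsScalarTower F X (LayerModule lo hi he ρ) :=
  inferInstanceAs (IsScalarTower F X
    ((layerMul lo hi u ⊗[F] V) ⧸ balancing lo hi he ρ))

/-- The submodule of the elements annihilated by `hi / lo`. -/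
def layerNull : Submodule (LayerRing lo) (LayerModule lo hi he ρ) where
  carrier := {w | ∀ r ∈ layer lo hi, r • w = 0}
  zero_mem' := fun _ _ => smul_zero _
  add_mem' := fun {a b} ha hb r hr => by rw [smul_add, ha r hr, hb r hr, add_zero]
  smul_mem' := fun s w hw r hr => by
    rw [← mul_smul]
    exact hw _ (layer_mul_mem hr s)

variable (F) in
/-- `Q` is irreducible as a module over the (not necessarily unital) algebra `hi / lo`: the algebra
acts nontrivially, and there are no invariant subspaces apart from zero and `Q`. -/
def LayerIrreducible (lo hi : TwoSidedIdeal X) (Q : Type*) [AddCommGroup Q] [Module F Q]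
    [Module (LayerRing lo) Q] : Prop :=
  (∃ r ∈ layer lo hi, ∃ q : Q, r • q ≠ 0) ∧
    ∀ W : Submodule F Q, (∀ r ∈ layer lo hi, ∀ w ∈ W, r • w ∈ W) → W = ⊥ ∨ W = ⊤

end Layers

/-! ### The modules `M(μ)` and `N(μ)` -/

section Main

variable (F : Type*) [Field F] (k : Kind) (x : F) {n : ℕ}

theorem idem_mul_smallPerm {m : ℕ} (h : m ≤ n) (σ : Equiv.Perm (Fin m)) :
    XAlg.of F x (.idem n m) (k.noHorizontal_mem (Diagram.noHorizontal_idem m)) *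
      XAlg.of F x (.smallPerm h σ) (k.noHorizontal_mem (Diagram.noHorizontal_ofPerm _)) =
    XAlg.of F x (.smallPerm h σ) (k.noHorizontal_mem (Diagram.noHorizontal_ofPerm _)) *
      XAlg.of F x (.idem n m) (k.noHorizontal_mem (Diagram.noHorizontal_idem m)) := by
  apply Subtype.ext
  change AAlg.of x _ * AAlg.of x _ = AAlg.of x _ * AAlg.of x _
  rw [AAlg.of_mul_of, AAlg.of_mul_of, Diagram.idem_comp_smallPerm, Diagram.smallPerm,
    (Diagram.comp_ofPerm _ _).2, (Diagram.ofPerm_comp _ _).2]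

variable {μ : YoungDiagram} (h : μ.card ≤ n)

/-- The module `M(μ) = 𝕀_n^m 𝔲_{n,n-m} ⊗_{S_m} S^μ`, where `m` is the size of the partition `μ` (given
by its Young diagram) and `𝕀_n^m = 𝕏_n^m / 𝕏_n^{m-1}`. It is a left `𝕏_n`-module, and `𝕀_n^m` acts
on it as an ideal of `𝕏_n / 𝕏_n^{m-1}`. -/
abbrev MMod : Type _ :=
  LayerModule (F := F) (V := Specht F μ) (below F k n x μ.card) (below F k n x (μ.card + 1))
    (idem_mul_smallPerm F k x h) (spechtRep F μ)

/-- The submodule `N(μ) = {w ∈ M(μ) | 𝕀_n^m w = 0}`. -/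
noncomputable abbrev NMod : Submodule (LayerRing (below F k n x μ.card)) (MMod F k x h) :=
  layerNull (F := F) (V := Specht F μ) (below F k n x μ.card) (below F k n x (μ.card + 1))
    (idem_mul_smallPerm F k x h) (spechtRep F μ)

end Main
end LoopBrauer

open LoopBrauer

/-!
The element `𝔲` with `m` straight vertical arcs satisfies `𝔲 𝔲 = x ^ ℓ 𝔲`, so it is an idempotent up to
a unit. Every diagram with exactly `m` vertical arcs is a nonzero multiple of a product `a 𝔲 b`, so `𝔲`
generates the layer of diagrams with `m` vertical arcs modulo the diagrams with fewer. Finally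
`𝔲 d 𝔲` is, for every diagram `d`, either a multiple of some `𝔲 σ` with `σ` in the symmetric group of
degree `m`, or has fewer than `m` vertical arcs: the corner of the layer is the group algebra of the
symmetric group (`isLayerGenerator_idemElt`).

This is all that is needed for a general argument (`IsLayerGenerator`). If `V` is an irreducible
representation of the group and `M` is the induced module, then `𝔲 M` is the image of `V`. Hence a
submodule `W` of `M` either contains the image of `V`, and is then everything because this image
generates `M`, or is killed by `𝔲`, and then by the whole layer. So the part `N` of `M` annihilated by
the layer contains every proper submodule (`IsLayerGenerator.le_layerNull`). It is itself proper,
because `v ↦ 𝔲 ⊗ v` is injective, as reading off the coefficients of the diagrams `𝔲 σ` shows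
(`toLayerModule_ne_zero`). The first two parts of the theorem follow.

The argument needs the irreducibility of the Specht modules in characteristic zero
(`Specht.eq_bot_or_eq_top`). The signed column sum of a tableau `T` maps all tabloids of the same shape
into the line of the polytabloid of `T`, and multiplies this polytabloid by the order of the column
group. Thus it is nonzero on one of any two complementary subrepresentations, which then contains the
polytabloid, a generator.

For an arbitrary irreducible module `V`, take the lowest layer that acts on it nontrivially. Then `𝔲 V`
is a nonzero representation of the symmetric group and receives a nonzero map from some Specht module,
which extends to a nonzero, hence surjective, map from `M` to `V`; its kernel is a maximal submodule and
therefore equal to `N`. That every nonzero representation receives a map from a Specht module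
(`exists_specht_hom`) is a count of characters. The Specht modules of different shapes are not
isomorphic, since a nonzero map forces one shape to dominate the other; so their characters are
orthogonal and linearly independent, and there are at least as many of them as there are cycle types.
They therefore span the class functions, and a representation whose character is orthogonal to all of
them is zero.
-/

namespace LoopBrauer

/-! ### Products of diagrams -/

/-- A map to a graph with degrees at most one that contracts or preserves every edge, and under which
every edge between images of marked vertices comes from a path, computes the join. -/
theorem joinGraph_eq_comap {W V O : Type*} {H : SimpleGraph W} {K : SimpleGraph V}
    (hK : ∀ u v w, K.Adj u v → K.Adj u w → v = w) {o : O → W} (f : W → V)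
    (h₁ : ∀ w w', H.Adj w w' → f w = f w' ∨ K.Adj (f w) (f w'))
    (h₂ : ∀ s t, K.Adj (f (o s)) (f (o t)) → H.Reachable (o s) (o t))
    (hf : Function.Injective (f ∘ o)) : joinGraph H o = K.comap (f ∘ o) := by
  ext s t
  constructor
  · rintro ⟨hne, hr⟩
    have hr' : K.Reachable (f (o s)) (f (o t)) := reach_map f (fun w w' a => by
      rcases h₁ w w' a with e | a
      · rw [e]
      · exact a.reachable) hr
    obtain ⟨p, hp⟩ := hr'.exists_isPath
    have hne' : f (o s) ≠ f (o t) := fun e => hne (hf e)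
    obtain ⟨v, a, p', rfl⟩ := SimpleGraph.Walk.exists_eq_cons_of_ne hne' p
    rw [SimpleGraph.Walk.cons_isPath_iff] at hp
    by_cases e : v = f (o t)
    · subst e
      exact a
    · obtain ⟨v', a', p'', rfl⟩ := SimpleGraph.Walk.exists_eq_cons_of_ne e p'
      have := hK _ _ _ a.symm a'
      subst this
      simp at hp
  · intro a
    refine ⟨?_, h₂ _ _ a⟩
    rintro rfl
    exact a.ne rfl

theorem reach_invariant {W : Type*} {H : SimpleGraph W} {P : W → Prop}
    (hP : ∀ w w', H.Adj w w' → P w → P w') {w w' : W} (h : H.Reachable w w') (hw : P w) : P w' := by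
  obtain ⟨r⟩ := h
  induction r with
  | nil => exact hw
  | cons a _ ih => exact ih (hP _ _ a hw)

namespace Diagram

variable {n m : ℕ}

/-- A vertex is a bottom vertex only if its index is less than `m`. -/
def BotLt (m : ℕ) : Fin n ⊕ Fin n → Prop
  | .inl _ => True
  | .inr i => (i : ℕ) < m

/-- A vertex is a top vertex only if its index is less than `m`. -/
def TopLt (m : ℕ) : Fin n ⊕ Fin n → Prop
  | .inl i => (i : ℕ) < m
  | .inr _ => True

/-- Multiplying by `idem n m` on the right removes the arcs that end in a bottom vertex whose index
is at least `m`. -/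
theorem comp_idem_adj (d : Diagram n) (p q : Fin n ⊕ Fin n) :
    (comp d (idem n m)).graph.Adj p q ↔ d.graph.Adj p q ∧ BotLt m p ∧ BotLt m q := by
  classical
  let f : (Fin n ⊕ Fin n) ⊕ (Fin n ⊕ Fin n) → (Fin n ⊕ Fin n) ⊕ Fin n
    | .inl v => .inl v
    | .inr (.inl i) => .inl (.inr i)
    | .inr (.inr i) => if (i : ℕ) < m then .inl (.inr i) else .inr i
  have hf : ∀ p : Fin n ⊕ Fin n, f (outer p) = .inl p ∧ BotLt m p ∨
      ∃ i, p = .inr i ∧ f (outer p) = .inr i ∧ ¬ BotLt m p := by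
    rintro (i | i)
    · exact .inl ⟨rfl, trivial⟩
    · by_cases h : (i : ℕ) < m
      · exact .inl ⟨if_pos h, h⟩
      · exact .inr ⟨i, rfl, if_neg h, h⟩
  have key := joinGraph_eq_comap (H := stack d (idem n m)) (K := d.graph ⊕g ⊥) (o := outer)
    ?_ f ?_ ?_ ?_
  · change (joinGraph _ _).Adj p q ↔ _
    rw [key]
    change (d.graph ⊕g (⊥ : SimpleGraph (Fin n))).Adj (f (outer p)) (f (outer q)) ↔ _
    rcases hf p with ⟨h, h'⟩ | ⟨i, -, h, h'⟩ <;> rcases hf q with ⟨k, k'⟩ | ⟨j, -, k, k'⟩ <;>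
      simp [h, k, h', k']
  · rintro (u | u) (v | v) (w | w) h₁ h₂ <;> simp at h₁ h₂
    rw [d.matching _ _ _ h₁ h₂]
  · rintro ((i | i) | (i | i)) ((j | j) | (j | j)) h
    all_goals first
      | exact False.elim h
      | exact .inr h
      | (have h : i = j := h; subst h; exact .inl rfl)
      | skip
    all_goals
      obtain ⟨k, hk, ⟨h₁, h₂⟩ | ⟨h₁, h₂⟩⟩ := h <;> cases h₁ <;> cases h₂
    all_goals simp [f, hk]
  · have hr : ∀ p : Fin n ⊕ Fin n, f (outer p) = .inl p →
        (stack d (idem n m)).Reachable (outer p) (.inl p) := by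
      rintro (i | i) h
      · rfl
      · have hi : (i : ℕ) < m := by
          by_contra hi
          simp [f, outer, hi] at h
        have h₁ : (stack d (idem n m)).Adj (.inr (.inr i)) (.inr (.inl i)) :=
          ⟨i, hi, .inr ⟨rfl, rfl⟩⟩
        have h₂ : (stack d (idem n m)).Adj (.inr (.inl i)) (.inl (.inr i)) := by
          simp [stack, stackAdj]
        exact h₁.reachable.trans h₂.reachable
    intro s t a
    rcases hf s with ⟨h, h'⟩ | ⟨i, -, h, h'⟩ <;> rcases hf t with ⟨k, k'⟩ | ⟨j, -, k, k'⟩ <;>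
      simp [h, k] at a
    have a' : (stack d (idem n m)).Adj (.inl s) (.inl t) := a
    exact (hr s h).trans (a'.reachable.trans (hr t k).symm)
  · intro s t e
    simp only [Function.comp_apply] at e
    rcases hf s with ⟨h, h'⟩ | ⟨i, rfl, h, h'⟩ <;> rcases hf t with ⟨k, k'⟩ | ⟨j, rfl, k, k'⟩ <;>
      rw [h, k] at e <;> simp at e <;> simp [e]

/-- Multiplying by `idem n m` on the left removes the arcs that end in a top vertex whose index is
at least `m`. -/
theorem idem_comp_adj (d : Diagram n) (p q : Fin n ⊕ Fin n) :
    (comp (idem n m) d).graph.Adj p q ↔ d.graph.Adj p q ∧ TopLt m p ∧ TopLt m q := by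
  classical
  let f : (Fin n ⊕ Fin n) ⊕ (Fin n ⊕ Fin n) → (Fin n ⊕ Fin n) ⊕ Fin n
    | .inr v => .inl v
    | .inl (.inr i) => .inl (.inl i)
    | .inl (.inl i) => if (i : ℕ) < m then .inl (.inl i) else .inr i
  have hf : ∀ p : Fin n ⊕ Fin n, f (outer p) = .inl p ∧ TopLt m p ∨
      ∃ i, p = .inl i ∧ f (outer p) = .inr i ∧ ¬ TopLt m p := by
    rintro (i | i)
    · by_cases h : (i : ℕ) < m
      · exact .inl ⟨if_pos h, h⟩
      · exact .inr ⟨i, rfl, if_neg h, h⟩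
    · exact .inl ⟨rfl, trivial⟩
  have key := joinGraph_eq_comap (H := stack (idem n m) d) (K := d.graph ⊕g ⊥) (o := outer)
    ?_ f ?_ ?_ ?_
  · change (joinGraph _ _).Adj p q ↔ _
    rw [key]
    change (d.graph ⊕g (⊥ : SimpleGraph (Fin n))).Adj (f (outer p)) (f (outer q)) ↔ _
    rcases hf p with ⟨h, h'⟩ | ⟨i, -, h, h'⟩ <;> rcases hf q with ⟨k, k'⟩ | ⟨j, -, k, k'⟩ <;>
      simp [h, k, h', k']
  · rintro (u | u) (v | v) (w | w) h₁ h₂ <;> simp at h₁ h₂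
    rw [d.matching _ _ _ h₁ h₂]
  · rintro ((i | i) | (i | i)) ((j | j) | (j | j)) h
    all_goals first
      | exact False.elim h
      | exact .inr h
      | (have h : i = j := h; subst h; exact .inl rfl)
      | skip
    all_goals
      obtain ⟨k, hk, ⟨h₁, h₂⟩ | ⟨h₁, h₂⟩⟩ := h <;> cases h₁ <;> cases h₂
    all_goals simp [f, hk]
  · have hr : ∀ p : Fin n ⊕ Fin n, f (outer p) = .inl p →
        (stack (idem n m) d).Reachable (outer p) (.inr p) := by
      rintro (i | i) h
      · have hi : (i : ℕ) < m := by
          by_contra hi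
          simp [f, outer, hi] at h
        have h₁ : (stack (idem n m) d).Adj (.inl (.inl i)) (.inl (.inr i)) :=
          ⟨i, hi, .inl ⟨rfl, rfl⟩⟩
        have h₂ : (stack (idem n m) d).Adj (.inl (.inr i)) (.inr (.inl i)) := by
          simp [stack, stackAdj]
        exact h₁.reachable.trans h₂.reachable
      · rfl
    intro s t a
    rcases hf s with ⟨h, h'⟩ | ⟨i, -, h, h'⟩ <;> rcases hf t with ⟨k, k'⟩ | ⟨j, -, k, k'⟩ <;>
      simp [h, k] at a
    have a' : (stack (idem n m) d).Adj (.inr s) (.inr t) := a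
    exact (hr s h).trans (a'.reachable.trans (hr t k).symm)
  · intro s t e
    simp only [Function.comp_apply] at e
    rcases hf s with ⟨h, h'⟩ | ⟨i, rfl, h, h'⟩ <;> rcases hf t with ⟨k, k'⟩ | ⟨j, rfl, k, k'⟩ <;>
      rw [h, k] at e <;> simp at e <;> simp [e]

theorem idem_comp_idem : comp (idem n m) (idem n m) = idem n m := by
  apply Diagram.ext
  ext p q
  rw [comp_idem_adj]
  refine and_iff_left_of_imp ?_
  rintro ⟨i, hi, ⟨rfl, rfl⟩ | ⟨rfl, rfl⟩⟩ <;> simp [BotLt, hi]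

/-- A path from the top to the bottom of `G(a, b)` crosses a vertical arc of `a`, and different
paths cross different arcs. -/
theorem verticals_comp_le_left (a b : Diagram n) : (comp a b).verticals ≤ a.verticals := by
  have key : ∀ i ∈ {i | ∃ j, (comp a b).graph.Adj (.inl i) (.inr j)},
      ∃ i', (∃ j, a.graph.Adj (.inl i') (.inr j)) ∧
        (stack a b).Reachable (outer (.inl i)) (.inl (.inl i')) := by
    rintro i ⟨j, -, hr⟩
    by_contra! hc
    have := reach_invariant (P := fun w => (stack a b).Reachable (outer (.inl i)) w ∧
      ∃ k, w = .inl (.inl k)) ?_ hr ⟨.refl _, i, rfl⟩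
    · obtain ⟨-, k, hk⟩ := this
      cases hk
    · rintro w w' h ⟨hw, k, rfl⟩
      refine ⟨hw.trans h.reachable, ?_⟩
      rcases w' with (l | l) | (l | l)
      · exact ⟨l, rfl⟩
      · exact (hc k ⟨l, h⟩ hw).elim
      · exact False.elim h
      · exact False.elim h
  choose! f hf using key
  refine Set.ncard_le_ncard_of_injOn f (fun i hi => (hf i hi).1) ?_ (Set.toFinite _)
  intro i hi i' hi' e
  by_contra hne
  obtain ⟨j, hj⟩ := hi
  have h' : (comp a b).graph.Adj (.inl i) (.inl i') :=
    ⟨by simpa using hne, (hf i ⟨j, hj⟩).2.trans (e ▸ (hf i' hi').2.symm)⟩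
  cases (comp a b).matching _ _ _ hj h'

theorem verticals_comp_le_right (a b : Diagram n) : (comp a b).verticals ≤ b.verticals := by
  have key : ∀ i ∈ {i | ∃ j, (comp a b).graph.Adj (.inl i) (.inr j)},
      ∃ i', (∃ j, b.graph.Adj (.inl i') (.inr j)) ∧
        (stack a b).Reachable (outer (.inl i)) (.inr (.inl i')) := by
    rintro i ⟨j, -, hr⟩
    by_contra! hc
    have := reach_invariant (P := fun w => (stack a b).Reachable (outer (.inl i)) w ∧
      ∃ k, w = .inr (.inr k)) ?_ hr.symm ⟨hr, j, rfl⟩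
    · obtain ⟨-, k, hk⟩ := this
      cases hk
    · rintro w w' h ⟨hw, k, rfl⟩
      refine ⟨hw.trans h.reachable, ?_⟩
      rcases w' with (l | l) | (l | l)
      · exact False.elim h
      · exact False.elim h
      · exact (hc l ⟨k, SimpleGraph.Adj.symm h⟩ (hw.trans h.reachable)).elim
      · exact ⟨l, rfl⟩
  choose! f hf using key
  refine Set.ncard_le_ncard_of_injOn f (fun i hi => (hf i hi).1) ?_ (Set.toFinite _)
  intro i hi i' hi' e
  by_contra hne
  obtain ⟨j, hj⟩ := hi
  have h' : (comp a b).graph.Adj (.inl i) (.inl i') :=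
    ⟨by simpa using hne, (hf i ⟨j, hj⟩).2.trans (e ▸ (hf i' hi').2.symm)⟩
  cases (comp a b).matching _ _ _ hj h'

theorem verticals_le (d : Diagram n) : d.verticals ≤ n :=
  (Set.ncard_le_card _).trans (by simp)

theorem ncard_lt (h : m ≤ n) : {i : Fin n | (i : ℕ) < m}.ncard = m := by
  have : {i : Fin n | (i : ℕ) < m} = Set.range (Fin.castLE h) := by
    ext i; simp [Fin.range_castLE]
  rw [this, ← Set.image_univ, Set.ncard_image_of_injective _ (Fin.castLE_injective h)]
  simp

theorem verticals_idem (h : m ≤ n) : (idem n m).verticals = m := by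
  rw [verticals]
  convert ncard_lt h with i
  constructor
  · rintro ⟨j, k, hk, ⟨h₁, h₂⟩ | ⟨h₁, h₂⟩⟩ <;> cases h₁
    exact hk
  · exact fun hi => ⟨i, i, hi, .inl ⟨rfl, rfl⟩⟩

theorem ofPerm_comp_ofPerm (σ τ : Equiv.Perm (Fin n)) :
    comp (ofPerm σ) (ofPerm τ) = ofPerm (σ * τ) := by
  apply Diagram.ext
  rw [(comp_ofPerm _ _).1]
  ext (i | i) (j | j) <;> simp [ofPerm]

/-- The vertical arcs of `d` are exactly the straight ones at the first `m` vertices. -/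
def Straight (m : ℕ) (d : Diagram n) : Prop :=
  ∀ i j, d.graph.Adj (.inl i) (.inr j) ↔ i = j ∧ (i : ℕ) < m

/-- A diagram with straight vertical arcs factors through `idem n m`: its top horizontal arcs come
from the left factor and its bottom ones from the right factor. -/
theorem Straight.comp_idem_comp {d : Diagram n} (hd : d.Straight m) :
    comp (comp d (idem n m)) d = d := by
  classical
  have hd' : ∀ i j, d.graph.Adj (.inr j) (.inl i) ↔ i = j ∧ (i : ℕ) < m := fun i j => by
    rw [SimpleGraph.adj_comm, hd]
  have hbot : ∀ i j : Fin n, (i : ℕ) < m → ¬ d.graph.Adj (.inr i) (.inr j) := fun i j hi h => by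
    cases d.matching _ _ _ h ((hd' i i).2 ⟨rfl, hi⟩)
  have htop : ∀ i j : Fin n, (i : ℕ) < m → ¬ d.graph.Adj (.inl i) (.inl j) := fun i j hi h => by
    cases d.matching _ _ _ h ((hd i i).2 ⟨rfl, hi⟩)
  -- contract each straight path to its top vertex and everything else in the middle to a point;
  -- all arcs in the middle are horizontal ones at vertices with index at least `m`
  let f : (Fin n ⊕ Fin n) ⊕ (Fin n ⊕ Fin n) → (Fin n ⊕ Fin n) ⊕ Unit
    | .inl (.inl i) => .inl (.inl i)
    | .inl (.inr i) => if (i : ℕ) < m then .inl (.inl i) else .inr ()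
    | .inr (.inl i) => if (i : ℕ) < m then .inl (.inl i) else .inr ()
    | .inr (.inr i) => .inl (.inr i)
  have hf : ∀ p, f (outer p) = .inl p := by rintro (i | i) <;> rfl
  apply Diagram.ext
  have key := joinGraph_eq_comap (H := stack (comp d (idem n m)) d) (K := d.graph ⊕g ⊥)
    (o := outer) ?_ f ?_ ?_ ?_
  · refine key.trans ?_
    ext p q
    simp [hf]
  · rintro (u | u) (v | v) (w | w) h₁ h₂ <;> simp at h₁ h₂
    rw [d.matching _ _ _ h₁ h₂]
  · rintro ((i | i) | (i | i)) ((j | j) | (j | j)) h <;>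
      simp only [stack, stackAdj, comp_idem_adj, BotLt] at h
    · exact .inr h.1
    · obtain ⟨rfl, hi⟩ := (hd _ _).1 h.1
      exact .inl (by simp [f, hi])
    · obtain ⟨rfl, hi⟩ := (hd' _ _).1 h.1
      exact .inl (by simp [f, hi])
    · exact (hbot _ _ h.2.1 h.1).elim
    · exact .inl (by simp [f, h])
    · exact .inl (by simp [f, h])
    · have hi : ¬ (i : ℕ) < m := fun hi => htop _ _ hi h
      have hj : ¬ (j : ℕ) < m := fun hj => htop _ _ hj h.symm
      exact .inl (by simp [f, hi, hj])
    · obtain ⟨rfl, hi⟩ := (hd _ _).1 h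
      exact .inr (by simpa [f, hi] using h)
    · obtain ⟨rfl, hi⟩ := (hd' _ _).1 h
      exact .inr (by simpa [f, hi] using h)
    · exact .inr h
  · intro s t a
    rw [hf, hf] at a
    replace a : d.graph.Adj s t := a
    have hv : ∀ i j, d.graph.Adj (.inl i) (.inr j) →
        (stack (comp d (idem n m)) d).Reachable (outer (.inl i)) (outer (.inr j)) := by
      intro i j h
      obtain ⟨rfl, hi⟩ := (hd _ _).1 h
      have h₁ : (stack (comp d (idem n m)) d).Adj (.inl (.inl i)) (.inl (.inr i)) :=
        (comp_idem_adj _ _ _).2 ⟨h, trivial, hi⟩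
      have h₂ : (stack (comp d (idem n m)) d).Adj (.inl (.inr i)) (.inr (.inl i)) := by
        simp [stack, stackAdj]
      have h₃ : (stack (comp d (idem n m)) d).Adj (.inr (.inl i)) (.inr (.inr i)) := h
      exact h₁.reachable.trans (h₂.reachable.trans h₃.reachable)
    rcases s with s | s <;> rcases t with t | t
    · refine SimpleGraph.Adj.reachable ?_
      exact (comp_idem_adj _ _ _).2 ⟨a, trivial, trivial⟩
    · exact hv _ _ a
    · exact (hv _ _ a.symm).symm
    · exact SimpleGraph.Adj.reachable (show (stack _ d).Adj (.inr (.inr s)) (.inr (.inr t)) from a)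
  · intro s t e
    simpa [hf] using e

/-- Permuting the top and the bottom vertices makes all vertical arcs straight. -/
theorem exists_straight (d : Diagram n) : ∃ σ τ : Equiv.Perm (Fin n),
    (comp (comp (ofPerm σ) d) (ofPerm τ)).Straight d.verticals := by
  classical
  set m := d.verticals with hm
  let S := {i | ∃ j, d.graph.Adj (.inl i) (.inr j)}
  have hS : ∀ i : S, ∃ j, d.graph.Adj (.inl i.1) (.inr j) := fun i => i.2
  choose p hp using hS
  have hpinj : Function.Injective p := fun i j e => by
    have h₁ := (hp i).symm
    rw [e] at h₁
    exact Subtype.ext (Sum.inl_injective (d.matching _ _ _ h₁ (hp j).symm))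
  have hcard : Nat.card {i : Fin n // (i : ℕ) < m} = Nat.card S := by
    rw [Nat.card_coe_set_eq S]
    exact (Nat.card_coe_set_eq _).trans (ncard_lt d.verticals_le)
  let e : {i : Fin n // (i : ℕ) < m} ≃ {i // i ∈ S} := Classical.choice (Finite.card_eq.1 hcard)
  let e' : {i : Fin n // (i : ℕ) < m} ≃ {i // i ∈ Set.range p} :=
    e.trans (Equiv.ofInjective p hpinj)
  let α : Equiv.Perm (Fin n) := e.extendSubtype
  let β : Equiv.Perm (Fin n) := e'.extendSubtype
  have hα : ∀ (i : Fin n) (hi : (i : ℕ) < m), α i = e ⟨i, hi⟩ := fun i hi =>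
    e.extendSubtype_apply_of_mem i hi
  have hβ : ∀ (i : Fin n) (hi : (i : ℕ) < m), β i = p (e ⟨i, hi⟩) := fun i hi =>
    e'.extendSubtype_apply_of_mem i hi
  have hadj : ∀ i : Fin n, (i : ℕ) < m → d.graph.Adj (.inl (α i)) (.inr (β i)) := fun i hi => by
    rw [hα i hi, hβ i hi]; exact hp _
  refine ⟨α⁻¹, β, fun i j => ?_⟩
  rw [(comp_ofPerm _ _).1, SimpleGraph.comap_adj, (ofPerm_comp _ _).1, SimpleGraph.comap_adj]
  change d.graph.Adj (.inl (α i)) (.inr (β j)) ↔ _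
  constructor
  · intro h
    have hi : (i : ℕ) < m := by
      by_contra hi
      exact e.extendSubtype_not_mem i hi ⟨_, h⟩
    exact ⟨β.injective (Sum.inr_injective (d.matching _ _ _ (hadj i hi) h)), hi⟩
  · rintro ⟨rfl, hi⟩
    exact hadj i hi

/-- A diagram with `m` vertical arcs factors through `idem n m`, within diagrams of the same kind. -/
theorem exists_factor {k : Kind} {d : Diagram n} (hd : d ∈ k.diagrams n) :
    ∃ a ∈ k.diagrams n, ∃ b ∈ k.diagrams n, d = comp (comp a (idem n d.verticals)) b := by
  obtain ⟨σ, τ, h⟩ := d.exists_straight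
  set d' := comp (comp (ofPerm σ) d) (ofPerm τ) with hd'
  have hk : d' ∈ k.diagrams n := k.comp_mem (k.comp_mem (k.noHorizontal_mem
    (noHorizontal_ofPerm _)) hd) (k.noHorizontal_mem (noHorizontal_ofPerm _))
  refine ⟨comp (ofPerm σ⁻¹) d', k.comp_mem (k.noHorizontal_mem (noHorizontal_ofPerm _)) hk,
    comp d' (ofPerm τ⁻¹), k.comp_mem hk (k.noHorizontal_mem (noHorizontal_ofPerm _)), ?_⟩
  rw [← comp_assoc, comp_assoc (ofPerm σ⁻¹), comp_assoc (ofPerm σ⁻¹), h.comp_idem_comp, hd',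
    comp_assoc, comp_assoc, ofPerm_comp_ofPerm, mul_inv_cancel, comp_ofPerm_one, ← comp_assoc,
    ofPerm_comp_ofPerm, inv_mul_cancel, ofPerm_one_comp]

theorem smallPerm_mul (h : m ≤ n) (σ τ : Equiv.Perm (Fin m)) :
    smallPerm h (σ * τ) = comp (smallPerm h σ) (smallPerm h τ) := by
  rw [smallPerm, smallPerm, smallPerm, ofPerm_comp_ofPerm]
  exact congrArg ofPerm (map_mul (Equiv.Perm.viaEmbeddingHom (Fin.castLEEmb h)) σ τ)

theorem smallPerm_one (h : m ≤ n) : smallPerm h (1 : Equiv.Perm (Fin m)) = ofPerm 1 :=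
  congrArg ofPerm (map_one (Equiv.Perm.viaEmbeddingHom (Fin.castLEEmb h)))

/-- The diagram `𝔲 σ` has the vertical arcs from `σ k` to `k`, for `k < m`. -/
theorem idem_comp_smallPerm_adj (h : m ≤ n) (σ : Equiv.Perm (Fin m)) (i j : Fin n) :
    (comp (idem n m) (smallPerm h σ)).graph.Adj (.inl i) (.inr j) ↔
      ∃ k, j = Fin.castLE h k ∧ i = Fin.castLE h (σ k) := by
  rw [idem_comp_adj]
  have : (smallPerm h σ).graph.Adj (.inl i) (.inr j) ↔
      i = σ.viaEmbedding (Fin.castLEEmb h) j := by simp [smallPerm, ofPerm]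
  rw [this]
  constructor
  · rintro ⟨rfl, hi, -⟩
    have hj : (j : ℕ) < m := by
      by_contra hj
      refine hj ?_
      change ((σ.viaEmbedding (Fin.castLEEmb h) j : Fin n) : ℕ) < m at hi
      rwa [Equiv.Perm.viaEmbedding_apply_of_notMem] at hi
      rintro ⟨k, rfl⟩
      exact hj k.2
    exact ⟨⟨j, hj⟩, rfl, Equiv.Perm.viaEmbedding_apply σ (Fin.castLEEmb h) ⟨j, hj⟩⟩
  · rintro ⟨k, rfl, rfl⟩
    exact ⟨(Equiv.Perm.viaEmbedding_apply σ (Fin.castLEEmb h) k).symm, (σ k).2, trivial⟩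

theorem idem_comp_smallPerm_injective (h : m ≤ n) :
    Function.Injective fun σ : Equiv.Perm (Fin m) => comp (idem n m) (smallPerm h σ) := by
  intro σ τ e
  ext k
  have h₁ := (idem_comp_smallPerm_adj h σ _ _).2 ⟨k, rfl, rfl⟩
  change comp _ _ = comp _ _ at e
  rw [e, idem_comp_smallPerm_adj] at h₁
  obtain ⟨k', hk, hk'⟩ := h₁
  rw [Fin.castLE_inj] at hk hk'
  rw [hk', hk]

/-- The corner of the layer: `𝔲 d 𝔲` has fewer than `m` vertical arcs, or it is `𝔲 σ` for a
permutation `σ`. -/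
theorem idem_comp_comp_idem_cases (h : m ≤ n) (d : Diagram n) :
    (comp (comp (idem n m) d) (idem n m)).verticals < m ∨
      ∃ σ : Equiv.Perm (Fin m),
        comp (comp (idem n m) d) (idem n m) = comp (idem n m) (smallPerm h σ) := by
  rw [or_iff_not_imp_left, not_lt]
  intro hv
  set e := comp (comp (idem n m) d) (idem n m) with he
  have hadj : ∀ p q, e.graph.Adj p q → BotLt m p ∧ TopLt m p := fun p q a => by
    rw [he, comp_idem_adj, idem_comp_adj] at a
    exact ⟨a.2.1, a.1.2.1⟩
  have hS : {i | ∃ j, e.graph.Adj (.inl i) (.inr j)} = {i : Fin n | (i : ℕ) < m} :=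
    Set.eq_of_subset_of_ncard_le (fun i ⟨j, hj⟩ => (hadj _ _ hj).2) (by rwa [ncard_lt h])
      (Set.toFinite _)
  have hex : ∀ i : Fin m, ∃ j : Fin m,
      e.graph.Adj (.inl (Fin.castLE h i)) (.inr (Fin.castLE h j)) := fun i => by
    have hi : Fin.castLE h i ∈ {i | ∃ j, e.graph.Adj (.inl i) (.inr j)} := by
      rw [hS]; exact i.2
    obtain ⟨j, hj⟩ := hi
    exact ⟨⟨j, (hadj _ _ hj.symm).1⟩, hj⟩
  choose g hg using hex
  have ginj : Function.Injective g := fun i j hij => by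
    have h₁ := (hg i).symm
    rw [hij] at h₁
    exact Fin.castLE_injective h (Sum.inl_injective (e.matching _ _ _ h₁ (hg j).symm))
  -- all of the first `m` top vertices carry a vertical arc, so these arcs define a permutation
  let ρ : Equiv.Perm (Fin m) := Equiv.ofBijective g (Finite.injective_iff_bijective.1 ginj)
  have hρ : ∀ i, e.graph.Adj (.inl (Fin.castLE h i)) (.inr (Fin.castLE h (ρ i))) := hg
  refine ⟨ρ⁻¹, Diagram.ext ?_⟩
  have hver : ∀ i j, e.graph.Adj (.inl i) (.inr j) ↔
      (comp (idem n m) (smallPerm h ρ⁻¹)).graph.Adj (.inl i) (.inr j) := by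
    intro i j
    rw [idem_comp_smallPerm_adj]
    constructor
    · intro a
      have hi : (i : ℕ) < m := (hadj _ _ a).2
      exact ⟨ρ ⟨i, hi⟩, Sum.inr_injective (e.matching _ _ _ a (hρ ⟨i, hi⟩)), by simp⟩
    · rintro ⟨k, rfl, rfl⟩
      have := hρ (ρ⁻¹ k)
      rwa [show ρ (ρ⁻¹ k) = k from ρ.apply_symm_apply k] at this
  have hnh : (comp (idem n m) (smallPerm h ρ⁻¹)).NoHorizontal :=
    (noHorizontal_idem m).comp (noHorizontal_ofPerm _)
  ext (i | i) (j | j)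
  · refine iff_of_false (fun a => ?_) (hnh _ _).1
    cases e.matching _ _ _ a (hρ ⟨i, (hadj _ _ a).2⟩)
  · exact hver i j
  · rw [SimpleGraph.adj_comm, hver, SimpleGraph.adj_comm]
  · refine iff_of_false (fun a => ?_) (hnh _ _).2
    have := (hρ (ρ⁻¹ ⟨i, (hadj _ _ a).1⟩)).symm
    rw [show ρ (ρ⁻¹ _) = _ from ρ.apply_symm_apply _] at this
    cases e.matching _ _ _ a this

end Diagram

/-! ### Irreducibility of the Specht modules -/

/-- A function on the cells that is injective on every column dominates the row index of a column
permutation: send a cell to the rank of its value within its column. -/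
theorem exists_column_perm_le (μ : YoungDiagram) (f : {c // c ∈ μ.cells} → ℕ)
    (hf : ∀ c c', c.1.2 = c'.1.2 → f c = f c' → c = c') :
    ∃ π ∈ columnGroup μ, ∀ c, (π c).1.1 ≤ f c := by
  classical
  let B : {c // c ∈ μ.cells} → Finset {c // c ∈ μ.cells} := fun c =>
    Finset.univ.filter fun c' => c'.1.2 = c.1.2 ∧ f c' < f c
  have hB : ∀ c c', c' ∈ B c ↔ c'.1.2 = c.1.2 ∧ f c' < f c := fun c c' => by simp [B]
  have hle : ∀ c, (B c).card ≤ f c := fun c => by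
    refine (Finset.card_le_card_of_injOn f (t := Finset.range (f c)) ?_ ?_).trans
      (Finset.card_range _).le
    · intro c' h
      exact Finset.mem_coe.2 (Finset.mem_range.2 ((hB _ _).1 h).2)
    · intro c₁ h₁ c₂ h₂ e
      exact hf _ _ (((hB _ _).1 h₁).1.trans ((hB _ _).1 h₂).1.symm) e
  have hlt : ∀ c, (B c).card < μ.colLen c.1.2 := fun c => by
    rw [YoungDiagram.colLen_eq_card, ← Finset.card_map (Function.Embedding.subtype _)]
    refine Finset.card_lt_card ⟨?_, fun h => ?_⟩
    · intro c' h
      obtain ⟨c₁, h₁, rfl⟩ := Finset.mem_map.1 h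
      exact YoungDiagram.mem_col_iff.2 ⟨c₁.2, ((hB _ _).1 h₁).1⟩
    · obtain ⟨c₁, h₁, e⟩ := Finset.mem_map.1 (h (YoungDiagram.mem_col_iff.2 ⟨c.2, rfl⟩))
      obtain rfl : c₁ = c := Subtype.ext e
      exact lt_irrefl _ ((hB _ _).1 h₁).2
  let g : {c // c ∈ μ.cells} → {c // c ∈ μ.cells} := fun c =>
    ⟨((B c).card, c.1.2), (YoungDiagram.mem_cells _).2 (YoungDiagram.mem_iff_lt_colLen.2 (hlt c))⟩
  have hmono : ∀ c c', c.1.2 = c'.1.2 → f c < f c' → (B c).card < (B c').card := by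
    intro c c' e h
    refine Finset.card_lt_card ⟨fun d hd => ?_, fun hs => ?_⟩
    · rw [hB] at hd ⊢
      exact ⟨hd.1.trans e, hd.2.trans h⟩
    · exact lt_irrefl _ ((hB _ _).1 (hs ((hB _ _).2 ⟨e, h⟩))).2
  have hg : Function.Injective g := fun c c' e => by
    have e₁ : (B c).card = (B c').card := congrArg (fun c => c.1.1) e
    have e₂ : c.1.2 = c'.1.2 := congrArg (fun c => c.1.2) e
    rcases lt_trichotomy (f c) (f c') with h | h | h
    · exact absurd e₁ (hmono _ _ e₂ h).ne
    · exact hf _ _ e₂ h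
    · exact absurd e₁ (hmono _ _ e₂.symm h).ne'
  exact ⟨Equiv.ofBijective g (Finite.injective_iff_bijective.1 hg), fun c => rfl, hle⟩

section ColumnSum

variable {F : Type*} [Field F] {μ ν : YoungDiagram}
  {V W : Type*} [AddCommGroup V] [Module F V] [AddCommGroup W] [Module F W]

open Classical in
/-- The signed sum over the column group of the tableau `T`, as an operator on a representation. -/
noncomputable def columnSum (ρ : Representation F (Equiv.Perm (Fin μ.card)) V) (T : Tableau μ) :
    V →ₗ[F] V :=
  ∑ π : columnGroup μ, ((Equiv.Perm.sign π.1 : ℤ) : F) • ρ (T.permCongr π.1)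

theorem columnSum_map {ρ : Representation F (Equiv.Perm (Fin μ.card)) V}
    {σ : Representation F (Equiv.Perm (Fin μ.card)) W} {f : V →ₗ[F] W}
    (hf : ∀ g v, f (ρ g v) = σ g (f v)) (T : Tableau μ) (v : V) :
    f (columnSum ρ T v) = columnSum σ T (f v) := by
  simp [columnSum, LinearMap.sum_apply, hf]

theorem columnSum_mem {ρ : Representation F (Equiv.Perm (Fin μ.card)) V} {U : Submodule F V}
    (hU : ∀ g, ∀ v ∈ U, ρ g v ∈ U) (T : Tableau μ) {v : V} (hv : v ∈ U) :
    columnSum ρ T v ∈ U := by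
  rw [columnSum, LinearMap.sum_apply]
  exact U.sum_mem fun π _ => U.smul_mem _ (hU _ _ hv)

theorem intCast_sign_mul_self {α : Type*} [Fintype α] [DecidableEq α] (σ : Equiv.Perm α) :
    ((Equiv.Perm.sign σ : ℤ) : F) * ((Equiv.Perm.sign σ : ℤ) : F) = 1 := by
  rw [← Int.cast_mul, ← Units.val_mul, Int.units_mul_self]
  simp

open Classical in
/-- The column sum absorbs a column permutation up to its sign. -/
theorem columnSum_perm (ρ : Representation F (Equiv.Perm (Fin μ.card)) V) (T : Tableau μ)
    {π : Equiv.Perm {c // c ∈ μ.cells}} (hπ : π ∈ columnGroup μ) (v : V) :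
    columnSum ρ T (ρ (T.permCongr π) v) =
      ((Equiv.Perm.sign π : ℤ) : F) • columnSum ρ T v := by
  simp only [columnSum, LinearMap.sum_apply, LinearMap.smul_apply, Finset.smul_sum]
  refine Fintype.sum_equiv (Equiv.mulRight ⟨π, hπ⟩) _ _ fun τ => ?_
  simp only [Equiv.coe_mulRight, Subgroup.coe_mul, map_mul, Equiv.permCongr_mul,
    Module.End.mul_apply, smul_smul, Units.val_mul, Int.cast_mul]
  rw [mul_left_comm, intCast_sign_mul_self, mul_one]

open Classical in
/-- The column sum is idempotent up to the order of the column group. -/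
theorem columnSum_columnSum (ρ : Representation F (Equiv.Perm (Fin μ.card)) V) (T : Tableau μ)
    (v : V) : columnSum ρ T (columnSum ρ T v) =
      (Fintype.card (columnGroup μ) : F) • columnSum ρ T v := by
  conv_lhs => rw [columnSum.eq_1 ρ T, ← columnSum.eq_1 ρ T]
  nth_rw 2 [columnSum]
  simp only [LinearMap.sum_apply, LinearMap.smul_apply, map_sum, map_smul]
  rw [Finset.sum_congr rfl fun π _ => by
    rw [columnSum_perm ρ T π.2 v, smul_smul, intCast_sign_mul_self, one_smul]]
  simp [Finset.card_univ, Nat.cast_smul_eq_nsmul]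

/-- If two entries of one column can be exchanged without changing `v`, the signed column sum of `v`
vanishes. -/
theorem columnSum_eq_zero [CharZero F] (ρ : Representation F (Equiv.Perm (Fin μ.card)) V)
    (T : Tableau μ) {a b : {c // c ∈ μ.cells}} (hab : a ≠ b) (hcol : a.1.2 = b.1.2) {v : V}
    (hv : ρ (Equiv.swap (T a) (T b)) v = v) : columnSum ρ T v = 0 := by
  classical
  have hmem : Equiv.swap a b ∈ columnGroup μ := fun c => by
    by_cases h₁ : c = a
    · rw [h₁, Equiv.swap_apply_left, hcol]
    by_cases h₂ : c = b
    · rw [h₂, Equiv.swap_apply_right, hcol]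
    rw [Equiv.swap_apply_of_ne_of_ne h₁ h₂]
  have hs : T.permCongr (Equiv.swap a b) = Equiv.swap (T a) (T b) :=
    Equiv.symm_trans_swap_trans a b T
  have h := columnSum_perm ρ T hmem v
  rw [hs, hv, Equiv.Perm.sign_swap hab] at h
  have h₂ : (2 : F) • columnSum ρ T v = 0 := by
    rw [two_smul]
    exact add_eq_zero_iff_eq_neg.2 (by simpa using h)
  exact (smul_eq_zero.1 h₂).resolve_left two_ne_zero

/-- The tabloid of `T`, for a tableau with an arbitrary set of entries. -/
def rowWord {ι : Type*} (T : {c // c ∈ μ.cells} ≃ ι) (e : ι) : ℕ := (T.symm e).1.1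

theorem tabloidRep_single (σ : Equiv.Perm (Fin μ.card)) (t : Fin μ.card → ℕ) (a : F) :
    tabloidRep F μ σ (Finsupp.single t a) = Finsupp.single (fun e => t (σ⁻¹ e)) a :=
  Finsupp.mapDomain_single

theorem columnSum_rowWord (T : Tableau μ) :
    columnSum (tabloidRep F μ) T (Finsupp.single (rowWord T) 1) = polytabloid F μ T := by
  classical
  rw [columnSum, polytabloid, LinearMap.sum_apply]
  refine Fintype.sum_equiv (Equiv.inv _) _ _ fun π => ?_
  rw [LinearMap.smul_apply, tabloidRep_single, Finsupp.smul_single, smul_eq_mul, mul_one]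
  congr 1
  · funext e
    exact congrArg (fun c => c.1.1) (T.symm_apply_apply _)
  · simp

/-- The span of the tabloids of shape `μ` inside the space of all words. -/
noncomputable def tabloidSpan (F : Type*) [Field F] (μ : YoungDiagram) (ι : Type*) :
    Submodule F ((ι → ℕ) →₀ F) :=
  Submodule.span F (Set.range fun T : {c // c ∈ μ.cells} ≃ ι => Finsupp.single (rowWord T) 1)

theorem spechtSubmodule_le_tabloidSpan :
    spechtSubmodule F μ ≤ tabloidSpan F μ (Fin μ.card) := by
  refine Submodule.span_le.2 ?_
  rintro _ ⟨T, rfl⟩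
  refine Submodule.sum_mem _ fun π _ => ?_
  rw [← mul_one ((_ : ℤ) : F), ← smul_eq_mul, ← Finsupp.smul_single]
  exact Submodule.smul_mem _ _ (Submodule.subset_span ⟨(π.1⁻¹ : Equiv.Perm _).trans T, rfl⟩)

/-- A tabloid with a nonzero column sum has the entries of each column of `T` in different rows. -/
theorem injOn_columns_of_columnSum_ne_zero [CharZero F] (T : Tableau μ) {t : Fin μ.card → ℕ}
    (h : columnSum (tabloidRep F μ) T (Finsupp.single t 1) ≠ 0) (a b : {c // c ∈ μ.cells})
    (hcol : a.1.2 = b.1.2) (e : t (T a) = t (T b)) : a = b := by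
  by_contra hab
  refine h (columnSum_eq_zero _ T hab hcol ?_)
  rw [tabloidRep_single]
  congr 1
  funext i
  rw [Equiv.swap_inv]
  by_cases h₁ : i = T a
  · rw [h₁, Equiv.swap_apply_left, e]
  by_cases h₂ : i = T b
  · rw [h₂, Equiv.swap_apply_right, e]
  rw [Equiv.swap_apply_of_ne_of_ne h₁ h₂]

/-- The column sum of `T` maps every tabloid of the same shape to a multiple of the polytabloid of
`T`. -/
theorem columnSum_mem_span_polytabloid [CharZero F] (T : Tableau μ) {v : (Fin μ.card → ℕ) →₀ F}
    (hv : v ∈ tabloidSpan F μ (Fin μ.card)) :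
    columnSum (tabloidRep F μ) T v ∈ Submodule.span F {polytabloid F μ T} := by
  classical
  suffices h : tabloidSpan F μ (Fin μ.card) ≤
      (Submodule.span F {polytabloid F μ T}).comap (columnSum (tabloidRep F μ) T) by exact h hv
  refine Submodule.span_le.2 ?_
  rintro _ ⟨T', rfl⟩
  change columnSum (tabloidRep F μ) T (Finsupp.single (rowWord T') 1) ∈
    Submodule.span F {polytabloid F μ T}
  by_cases h0 : columnSum (tabloidRep F μ) T (Finsupp.single (rowWord T') 1) = 0
  · rw [h0]
    exact Submodule.zero_mem _
  obtain ⟨π, hπ, hle⟩ := exists_column_perm_le μ (fun c => rowWord T' (T c))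
    (injOn_columns_of_columnSum_ne_zero T h0)
  -- both sides have the same sum over all cells, so the inequalities are equalities
  have hsum : ∑ c, (π c).1.1 = ∑ c, rowWord T' (T c) := by
    rw [Equiv.sum_comp π fun c => c.1.1]
    exact (Equiv.sum_comp (T.trans T'.symm) fun c => c.1.1).symm
  have heq := (Finset.sum_eq_sum_iff_of_le fun c _ => hle c).1 hsum
  have hT : Finsupp.single (rowWord T') (1 : F) =
      tabloidRep F μ (T.permCongr π⁻¹) (Finsupp.single (rowWord T) 1) := by
    rw [tabloidRep_single]
    congr 1
    funext e
    have h := heq (T.symm e) (Finset.mem_univ _)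
    rw [Equiv.apply_symm_apply] at h
    rw [← h]
    exact congrArg (fun c => c.1.1) (T.symm_apply_apply (π (T.symm e))).symm
  rw [hT, columnSum_perm _ T (inv_mem hπ), columnSum_rowWord]
  exact Submodule.smul_mem _ _ (Submodule.mem_span_singleton_self _)

theorem polytabloid_ne_zero (T : Tableau μ) : polytabloid F μ T ≠ 0 := by
  classical
  intro h
  have h' := DFunLike.congr_fun h (rowWord T)
  rw [polytabloid, Finsupp.finsetSum_apply, Finset.sum_eq_single 1] at h'
  · simp at h'
    exact one_ne_zero (Finsupp.single_eq_same.symm.trans h')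
  · intro π _ hπ
    rw [Finsupp.single_apply, if_neg]
    intro e
    refine hπ (Subtype.ext (Equiv.ext fun c => Subtype.ext (Prod.ext ?_ (π.2 c))))
    have := congrFun e (T c)
    simpa [rowWord] using this
  · simp

/-- The polytabloid of `T` as an element of the Specht module. -/
noncomputable def Specht.polytabloid (F : Type*) [Field F] (T : Tableau μ) : Specht F μ :=
  (⟨LoopBrauer.polytabloid F μ T, Submodule.subset_span ⟨T, rfl⟩⟩ : spechtSubmodule F μ)

/-- The inclusion of the Specht module into the space of words. -/
noncomputable def Specht.incl (F : Type*) [Field F] (μ : YoungDiagram) :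
    Specht F μ →ₗ[F] ((Fin μ.card → ℕ) →₀ F) := (spechtSubmodule F μ).subtype

theorem Specht.incl_injective : Function.Injective (Specht.incl F μ) := Subtype.val_injective

theorem Specht.incl_polytabloid (T : Tableau μ) :
    Specht.incl F μ (Specht.polytabloid F T) = LoopBrauer.polytabloid F μ T := rfl

theorem Specht.incl_rep (σ : Equiv.Perm (Fin μ.card)) (s : Specht F μ) :
    Specht.incl F μ (spechtRep F μ σ s) = tabloidRep F μ σ (Specht.incl F μ s) := rfl

theorem Specht.incl_mem (s : Specht F μ) : Specht.incl F μ s ∈ tabloidSpan F μ (Fin μ.card) :=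
  spechtSubmodule_le_tabloidSpan s.2

theorem Specht.span_polytabloid : Submodule.span F (Set.range (Specht.polytabloid F (μ := μ))) = ⊤ := by
  refine Submodule.map_injective_of_injective Specht.incl_injective ?_
  rw [Submodule.map_span, ← Set.range_comp, Submodule.map_top]
  exact (Submodule.range_subtype _).symm

theorem Specht.columnSum_polytabloid (T : Tableau μ) [Fintype (columnGroup μ)] :
    columnSum (spechtRep F μ) T (Specht.polytabloid F T) =
      (Fintype.card (columnGroup μ) : F) • Specht.polytabloid F T := by
  classical
  apply Specht.incl_injective
  rw [columnSum_map Specht.incl_rep, map_smul, Specht.incl_polytabloid, ← columnSum_rowWord,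
    columnSum_columnSum]
  congr!

theorem Specht.eq_top_of_polytabloid_mem {U : Submodule F (Specht F μ)}
    (hU : ∀ g, ∀ s ∈ U, spechtRep F μ g s ∈ U) {T : Tableau μ}
    (hT : Specht.polytabloid F T ∈ U) : U = ⊤ := by
  rw [eq_top_iff, ← Specht.span_polytabloid, Submodule.span_le]
  rintro _ ⟨T', rfl⟩
  have h := hU (T.symm.trans T') _ hT
  have e : spechtRep F μ (T.symm.trans T') (Specht.polytabloid F T) = Specht.polytabloid F T' := by
    apply Specht.incl_injective
    rw [Specht.incl_rep, Specht.incl_polytabloid, Specht.incl_polytabloid, tabloidRep_polytabloid,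
      ← Equiv.trans_assoc, Equiv.self_trans_symm, Equiv.refl_trans]
  exact e ▸ h

instance : Nonempty (Tableau μ) :=
  ⟨(Finset.equivFin μ.cells).trans (finCongr rfl)⟩

instance : Nontrivial (Specht F μ) := by
  obtain ⟨T⟩ : Nonempty (Tableau μ) := inferInstance
  refine ⟨Specht.polytabloid F T, 0, fun h => polytabloid_ne_zero (F := F) T ?_⟩
  rw [← Specht.incl_polytabloid, h, map_zero]

/-- Specht modules are irreducible in characteristic zero. -/
theorem Specht.eq_bot_or_eq_top [CharZero F] {U : Submodule F (Specht F μ)}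
    (hU : ∀ g, ∀ s ∈ U, spechtRep F μ g s ∈ U) : U = ⊥ ∨ U = ⊤ := by
  classical
  obtain ⟨T⟩ : Nonempty (Tableau μ) := inferInstance
  have key : ∀ U : Submodule F (Specht F μ), (∀ g, ∀ s ∈ U, spechtRep F μ g s ∈ U) →
      (∃ u ∈ U, columnSum (spechtRep F μ) T u ≠ 0) → U = ⊤ := by
    rintro U hU ⟨u, hu, hne⟩
    have hmem := columnSum_mem_span_polytabloid T (Specht.incl_mem u)
    rw [← columnSum_map Specht.incl_rep] at hmem
    obtain ⟨a, ha⟩ := Submodule.mem_span_singleton.1 hmem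
    rw [← Specht.incl_polytabloid, ← map_smul] at ha
    replace ha := Specht.incl_injective ha
    have ha0 : a ≠ 0 := by
      rintro rfl
      exact hne (by rw [← ha, zero_smul])
    refine Specht.eq_top_of_polytabloid_mem hU (T := T) ?_
    have := columnSum_mem hU T hu
    rw [← ha] at this
    exact (U.smul_mem_iff ha0).1 this
  have : NeZero (Nat.card (Equiv.Perm (Fin μ.card)) : F) := ⟨by simp⟩
  -- Maschke: the polytabloid splits along a complement, and the column sum cannot kill both parts
  obtain ⟨U', hc⟩ := exists_isCompl (⟨U, hU⟩ : Subrepresentation (spechtRep F μ))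
  have hinf : U ⊓ U'.toSubmodule = ⊥ := congrArg Subrepresentation.toSubmodule hc.inf_eq_bot
  have hsup : U ⊔ U'.toSubmodule = ⊤ := congrArg Subrepresentation.toSubmodule hc.sup_eq_top
  have hT : Specht.polytabloid F T ∈ U ⊔ U'.toSubmodule := hsup ▸ Submodule.mem_top
  obtain ⟨u, hu, u', hu', e⟩ := Submodule.mem_sup.1 hT
  by_cases h : columnSum (spechtRep F μ) T u = 0
  · left
    have hU' : U'.toSubmodule = ⊤ := by
      refine key _ (fun g s hs => U'.apply_mem_toSubmodule g hs) ⟨u', hu', fun h' => ?_⟩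
      have h₁ := Specht.columnSum_polytabloid (F := F) T
      rw [← e, map_add, h, h', add_zero, e] at h₁
      have := (smul_eq_zero.1 h₁.symm).resolve_left
        (Nat.cast_ne_zero.2 Fintype.card_ne_zero)
      apply polytabloid_ne_zero (F := F) T
      rw [← Specht.incl_polytabloid, this, map_zero]
    rwa [hU', inf_top_eq] at hinf
  · exact .inr (key U hU ⟨u, hu, h⟩)

/-- A nonzero equivariant map from the Specht module of shape `μ` to the tabloids of shape `ν` forces
`μ` to dominate `ν`. -/
theorem card_rows_le_of_specht_hom [CharZero F] {θ : Specht F μ →ₗ[F] ((Fin μ.card → ℕ) →₀ F)}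
    (hθ : ∀ σ s, θ (spechtRep F μ σ s) = tabloidRep F μ σ (θ s)) (hne : θ ≠ 0)
    (hr : ∀ s, θ s ∈ tabloidSpan F ν (Fin μ.card)) (r : ℕ) :
    (ν.cells.filter fun c => c.1 < r).card ≤ (μ.cells.filter fun c => c.1 < r).card := by
  classical
  obtain ⟨T, hT⟩ : ∃ T, θ (Specht.polytabloid F T) ≠ 0 := by
    by_contra! h
    refine hne (LinearMap.ext_on Specht.span_polytabloid ?_)
    rintro _ ⟨T, rfl⟩
    exact h T
  have hκ : columnSum (tabloidRep F μ) T (θ (Specht.polytabloid F T)) ≠ 0 := by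
    rw [← columnSum_map hθ, Specht.columnSum_polytabloid, map_smul]
    exact smul_ne_zero (Nat.cast_ne_zero.2 Fintype.card_ne_zero) hT
  obtain ⟨T', hT'⟩ : ∃ T' : {c // c ∈ ν.cells} ≃ Fin μ.card,
      columnSum (tabloidRep F μ) T (Finsupp.single (rowWord T') 1) ≠ 0 := by
    by_contra! h
    have hle : tabloidSpan F ν (Fin μ.card) ≤ LinearMap.ker (columnSum (tabloidRep F μ) T) := by
      refine Submodule.span_le.2 ?_
      rintro _ ⟨T', rfl⟩
      exact h T'
    exact hκ (hle (hr _))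
  obtain ⟨π, -, hle⟩ := exists_column_perm_le μ (fun c => rowWord T' (T c))
    (injOn_columns_of_columnSum_ne_zero T hT')
  -- the bijection from the cells of `ν` to the cells of `μ` does not increase the row index
  have hmaps : ∀ c : {c // c ∈ ν.cells}, (π (T.symm (T' c))).1.1 ≤ c.1.1 := fun c => by
    simpa [rowWord] using hle (T.symm (T' c))
  refine Finset.card_le_card_of_injOn
    (fun c => if h : c ∈ ν.cells then (π (T.symm (T' ⟨c, h⟩))).1 else c) ?_ ?_
  · intro c hc
    obtain ⟨hc, hr⟩ := Finset.mem_filter.1 hc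
    simp only [dif_pos hc]
    exact Finset.mem_coe.2 (Finset.mem_filter.2 ⟨(π _).2, (hmaps ⟨c, hc⟩).trans_lt hr⟩)
  · intro c hc c' hc' e
    obtain ⟨hc, -⟩ := Finset.mem_filter.1 hc
    obtain ⟨hc', -⟩ := Finset.mem_filter.1 hc'
    simp only [dif_pos hc, dif_pos hc'] at e
    simpa using Subtype.ext e

/-- A Young diagram is determined by the numbers of cells in its first `r` rows. -/
theorem eq_of_card_rows_eq
    (h : ∀ r, (μ.cells.filter fun c => c.1 < r).card = (ν.cells.filter fun c => c.1 < r).card) :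
    μ = ν := by
  have hrow : ∀ (μ : YoungDiagram) r, (μ.cells.filter fun c => c.1 < r + 1).card =
      (μ.cells.filter fun c => c.1 < r).card + μ.rowLen r := fun μ r => by
    rw [YoungDiagram.rowLen_eq_card, ← Finset.card_union_of_disjoint]
    · congr 1
      ext c
      simp only [Finset.mem_filter, Finset.mem_union, YoungDiagram.mem_row_iff,
        YoungDiagram.mem_cells, Nat.lt_succ_iff_lt_or_eq, and_or_left]
    · rw [Finset.disjoint_left]
      intro c h₁ h₂
      exact (Finset.mem_filter.1 h₁).2.ne (YoungDiagram.mem_row_iff.1 h₂).2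
  have hlen : ∀ r, μ.rowLen r = ν.rowLen r := fun r => by
    have h₁ := hrow μ r
    have h₂ := hrow ν r
    rw [h, h r] at h₁
    omega
  refine YoungDiagram.ext (Finset.ext fun ⟨i, j⟩ => ?_)
  rw [YoungDiagram.mem_cells, YoungDiagram.mem_cells, YoungDiagram.mem_iff_lt_rowLen,
    YoungDiagram.mem_iff_lt_rowLen, hlen]

end ColumnSum

/-! ### Completeness of the Specht modules -/

section Completeness

variable {F : Type*} [Field F] {m : ℕ}

instance (μ : YoungDiagram) : FiniteDimensional F (Specht F μ) :=
  FiniteDimensional.span_of_finite F (Set.finite_range (polytabloid F μ))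

/-- The Specht module of shape `μ` as a representation of the symmetric group of degree `m = |μ|`. -/
noncomputable def spechtRepOf (F : Type*) [Field F] {μ : YoungDiagram} (h : μ.card = m) :
    Representation F (Equiv.Perm (Fin m)) (Specht F μ) :=
  (spechtRep F μ).comp (finCongr h.symm).permCongrHom.toMonoidHom

theorem spechtRepOf_rfl (μ : YoungDiagram) : spechtRepOf F (rfl : μ.card = μ.card) = spechtRep F μ :=
  MonoidHom.ext fun _ => rfl

/-- The inclusion of the Specht module into the words indexed by `Fin m`. -/
noncomputable def Specht.inclOf (F : Type*) [Field F] {μ : YoungDiagram} (h : μ.card = m) :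
    Specht F μ →ₗ[F] ((Fin m → ℕ) →₀ F) :=
  Finsupp.lmapDomain F F (fun t : Fin μ.card → ℕ => t ∘ finCongr h.symm) ∘ₗ Specht.incl F μ

theorem Specht.inclOf_injective {μ : YoungDiagram} (h : μ.card = m) :
    Function.Injective (Specht.inclOf F h) :=
  (Finsupp.mapDomain_injective (finCongr h.symm).surjective.injective_comp_right).comp
    Specht.incl_injective

theorem Specht.inclOf_rep {μ ν : YoungDiagram} (h : ν.card = μ.card)
    (σ : Equiv.Perm (Fin μ.card)) (s : Specht F ν) :
    Specht.inclOf F h (spechtRepOf F h σ s) = tabloidRep F μ σ (Specht.inclOf F h s) := by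
  have key : Finsupp.lmapDomain F F (fun t : Fin ν.card → ℕ => t ∘ finCongr h.symm) ∘ₗ
      tabloidRep F ν ((finCongr h.symm).permCongr σ) =
      tabloidRep F μ σ ∘ₗ Finsupp.lmapDomain F F (fun t : Fin ν.card → ℕ => t ∘ finCongr h.symm) := by
    refine Finsupp.lhom_ext fun t a => ?_
    simp only [LinearMap.comp_apply, tabloidRep_single, Finsupp.lmapDomain_apply,
      Finsupp.mapDomain_single]
    rfl
  exact LinearMap.congr_fun key (Specht.incl F ν s)

theorem Specht.inclOf_mem {μ : YoungDiagram} (h : μ.card = m) (s : Specht F μ) :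
    Specht.inclOf F h s ∈ tabloidSpan F μ (Fin m) := by
  have key : tabloidSpan F μ (Fin μ.card) ≤ (tabloidSpan F μ (Fin m)).comap
      (Finsupp.lmapDomain F F (fun t : Fin μ.card → ℕ => t ∘ finCongr h.symm)) := by
    refine Submodule.span_le.2 ?_
    rintro _ ⟨T, rfl⟩
    rw [SetLike.mem_coe, Submodule.mem_comap, Finsupp.lmapDomain_apply, Finsupp.mapDomain_single]
    exact Submodule.subset_span ⟨T.trans (finCongr h), rfl⟩
  exact key (Specht.incl_mem s)

theorem card_rows_le_of_intertwining [CharZero F] {μ ν : YoungDiagram} (hμ : μ.card = m)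
    (hν : ν.card = m) {f : (spechtRepOf F hμ).IntertwiningMap (spechtRepOf F hν)} (hf : f ≠ 0)
    (r : ℕ) :
    (ν.cells.filter fun c => c.1 < r).card ≤ (μ.cells.filter fun c => c.1 < r).card := by
  subst hμ
  refine card_rows_le_of_specht_hom (θ := Specht.inclOf F hν ∘ₗ f.toLinearMap) ?_ ?_ ?_ r
  · intro σ s
    rw [LinearMap.comp_apply, LinearMap.comp_apply, ← Specht.inclOf_rep, ← spechtRepOf_rfl]
    exact congrArg _ (Representation.IntertwiningMap.isIntertwining _ _ f σ s)
  · intro h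
    refine hf (Representation.IntertwiningMap.ext (LinearMap.ext fun s => ?_))
    apply Specht.inclOf_injective hν
    exact (LinearMap.congr_fun h s).trans (map_zero _).symm
  · exact fun s => Specht.inclOf_mem hν _

section Characters

variable {G : Type*} [Group G] {V W : Type*} [AddCommGroup V] [Module F V] [AddCommGroup W]
  [Module F W]

theorem finrank_intertwining_self_ne_zero [FiniteDimensional F V] [Nontrivial V]
    (ρ : Representation F G V) :
    Module.finrank F (ρ.IntertwiningMap ρ) ≠ 0 := by
  have : Nontrivial (ρ.IntertwiningMap ρ) := by
    obtain ⟨v, hv⟩ := exists_ne (0 : V)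
    exact ⟨.id ρ, 0, fun h => hv (congrArg (fun f => f v) h)⟩
  exact Module.finrank_pos.ne'

theorem exists_intertwining_ne_zero {ρ : Representation F G V} {σ : Representation F G W}
    (h : Module.finrank F (ρ.IntertwiningMap σ) ≠ 0) : ∃ f : ρ.IntertwiningMap σ, f ≠ 0 := by
  by_contra! h'
  have : Subsingleton (ρ.IntertwiningMap σ) := ⟨fun f g => by rw [h' f, h' g]⟩
  exact h Module.finrank_zero_of_subsingleton

variable [Fintype G] [CharZero F] [FiniteDimensional F V] [FiniteDimensional F W]

/-- The pairing of two characters is, up to the order of the group, the dimension of the space of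
intertwining maps. -/
theorem sum_character_mul_character (ρ : Representation F G V) (σ : Representation F G W) :
    ∑ g : G, σ.character g * ρ.character g⁻¹ =
      (Nat.card G : F) * Module.finrank F (ρ.IntertwiningMap σ) := by
  have hG : (Nat.card G : F) ≠ 0 := Nat.cast_ne_zero.2 Nat.card_pos.ne'
  have : Invertible (Nat.card G : F) := invertibleOfNonzero hG
  rw [← Representation.card_inv_mul_sum_char_mul_char_eq_finrank, mul_inv_cancel_left₀ hG]

/-- The pairing of characters is symmetric. -/
theorem finrank_intertwining_comm (ρ : Representation F G V) (σ : Representation F G W) :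
    Module.finrank F (ρ.IntertwiningMap σ) = Module.finrank F (σ.IntertwiningMap ρ) := by
  have hG : (Nat.card G : F) ≠ 0 := Nat.cast_ne_zero.2 Nat.card_pos.ne'
  have h : (Nat.card G : F) * Module.finrank F (ρ.IntertwiningMap σ) =
      (Nat.card G : F) * Module.finrank F (σ.IntertwiningMap ρ) := by
    rw [← sum_character_mul_character, ← sum_character_mul_character]
    refine Fintype.sum_equiv (Equiv.inv G) _ _ fun g => ?_
    simp [mul_comm]
  exact_mod_cast mul_left_cancel₀ hG h

/-- The character as a function on the conjugacy classes. -/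
noncomputable def classCharacter (ρ : Representation F G V) : ConjClasses G → F :=
  Quotient.lift ρ.character fun a b h => by
    obtain ⟨c, rfl⟩ := isConj_iff.1 h
    rw [ρ.char_conj]

/-- The pairing of class functions with the character of `ρ`. -/
noncomputable def characterPairing (ρ : Representation F G V) : (ConjClasses G → F) →ₗ[F] F where
  toFun φ := ∑ g : G, φ (ConjClasses.mk g) * ρ.character g⁻¹
  map_add' φ ψ := by simp [add_mul, Finset.sum_add_distrib]
  map_smul' a φ := by simp [mul_assoc, Finset.mul_sum]

theorem characterPairing_classCharacter (ρ : Representation F G V) (σ : Representation F G W) :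
    characterPairing ρ (classCharacter σ) =
      (Nat.card G : F) * Module.finrank F (ρ.IntertwiningMap σ) :=
  sum_character_mul_character ρ σ

end Characters

theorem card_ofRowLens {w : List ℕ} (hw : w.SortedGE) :
    (YoungDiagram.ofRowLens w hw).card = w.sum := by
  have : ∀ w : List ℕ, (YoungDiagram.cellsOfRowLens w).card = w.sum := by
    intro w
    induction w with
    | nil => rfl
    | cons a w ih =>
      rw [YoungDiagram.cellsOfRowLens, Finset.card_union_of_disjoint, Finset.card_map, ih]
      · simp
      · rw [Finset.disjoint_left]
        rintro ⟨i, j⟩ h₁ h₂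
        obtain ⟨⟨i', j'⟩, -, h₃⟩ := Finset.mem_map.1 h₂
        have e : i' + 1 = i := congrArg Prod.fst h₃
        have h₀ : i = 0 := by simpa using (Finset.mem_product.1 h₁).1
        omega
  exact this w

theorem exists_injective_partition (m : ℕ) :
    ∃ f : Nat.Partition m → {μ : YoungDiagram // μ.card = m}, Function.Injective f := by
  have hs : ∀ p : Nat.Partition m, (p.parts.sort (· ≥ ·)).SortedGE := fun p =>
    List.sortedGE_iff_pairwise.2 (Multiset.pairwise_sort _ _)
  refine ⟨fun p => ⟨YoungDiagram.ofRowLens _ (hs p), ?_⟩, fun p q e => ?_⟩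
  · rw [card_ofRowLens, ← Multiset.sum_coe, Multiset.sort_eq, p.parts_sum]
  · have e' := congrArg (fun μ => μ.1.rowLens) e
    have hpos : ∀ p : Nat.Partition m, ∀ x ∈ p.parts.sort (· ≥ ·), 0 < x := fun p x hx =>
      p.parts_pos ((Multiset.mem_sort _).1 hx)
    simp only [YoungDiagram.rowLens_ofRowLens_eq_self (hpos _)] at e'
    apply Nat.Partition.ext
    rw [← Multiset.sort_eq p.parts (· ≥ ·), e', Multiset.sort_eq]

/-- There are at least as many Young diagrams with `m` cells as conjugacy classes of the symmetric
group of degree `m`, as cycle types are partitions. -/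
theorem exists_injective_conjClasses (m : ℕ) :
    ∃ f : ConjClasses (Equiv.Perm (Fin m)) → {μ : YoungDiagram // μ.card = m},
      Function.Injective f := by
  obtain ⟨f, hf⟩ := exists_injective_partition (Fintype.card (Fin m))
  have hout : Function.Injective fun c : ConjClasses (Equiv.Perm (Fin m)) =>
      f (Equiv.Perm.partition (Quotient.out c)) := fun c c' e => by
    have h : IsConj (Quotient.out c) (Quotient.out c') :=
      Equiv.Perm.partition_eq_of_isConj.2 (hf e)
    rw [← Quotient.out_eq c, ← Quotient.out_eq c']
    exact Quotient.sound h
  exact ⟨fun c => ⟨(f (Equiv.Perm.partition (Quotient.out c))).1,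
    (f _).2.trans (Fintype.card_fin m)⟩, fun c c' e => hout (Subtype.ext (Subtype.mk.inj e))⟩

variable [CharZero F]

/-- The characters of the Specht modules span the class functions. -/
theorem span_classCharacter_specht (m : ℕ) :
    Submodule.span F (Set.range fun μ : {μ : YoungDiagram // μ.card = m} =>
      classCharacter (spechtRepOf F μ.2)) = ⊤ := by
  classical
  have hpair : ∀ μ ν : {μ : YoungDiagram // μ.card = m}, μ ≠ ν →
      characterPairing (spechtRepOf F μ.2) (classCharacter (spechtRepOf F ν.2)) = 0 := by
    intro μ ν hne
    rw [characterPairing_classCharacter, mul_eq_zero, Nat.cast_eq_zero (R := F),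
      Nat.cast_eq_zero (R := F)]
    right
    -- by symmetry there are nonzero maps in both directions, so the shapes dominate each other
    by_contra h
    obtain ⟨f, hf⟩ := exists_intertwining_ne_zero h
    rw [finrank_intertwining_comm] at h
    obtain ⟨g, hg⟩ := exists_intertwining_ne_zero h
    exact hne (Subtype.ext (eq_of_card_rows_eq fun r =>
      le_antisymm (card_rows_le_of_intertwining _ _ hg r) (card_rows_le_of_intertwining _ _ hf r)))
  have hli : LinearIndependent F fun μ : {μ : YoungDiagram // μ.card = m} =>
      classCharacter (spechtRepOf F μ.2) := by
    rw [linearIndependent_iff']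
    intro s a h μ hμ
    have h' := congrArg (characterPairing (spechtRepOf F μ.2)) h
    rw [map_sum, map_zero, Finset.sum_eq_single_of_mem μ hμ, map_smul, smul_eq_mul,
      mul_eq_zero] at h'
    · refine h'.resolve_right ?_
      rw [characterPairing_classCharacter]
      exact mul_ne_zero (Nat.cast_ne_zero.2 Nat.card_pos.ne')
        (Nat.cast_ne_zero.2 (finrank_intertwining_self_ne_zero _))
    · intro ν _ hν
      rw [map_smul, hpair μ ν hν.symm, smul_zero]
  have hfin : Finite {μ : YoungDiagram // μ.card = m} := hli.finite_of_isNoetherian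
  have := Fintype.ofFinite {μ : YoungDiagram // μ.card = m}
  obtain ⟨f, hf⟩ := exists_injective_conjClasses m
  refine hli.span_eq_top_of_card_eq_finrank' (le_antisymm hli.fintype_card_le_finrank ?_)
  rw [Module.finrank_fintype_fun_eq_card]
  exact Fintype.card_le_of_injective f hf

/-- Every nonzero representation of a symmetric group receives a nonzero equivariant map from some
Specht module. -/
theorem exists_specht_hom {V : Type*} [AddCommGroup V] [Module F V] [Nontrivial V]
    (ρ : Representation F (Equiv.Perm (Fin m)) V) :
    ∃ (μ : YoungDiagram) (h : μ.card = m) (f : Specht F μ →ₗ[F] V), f ≠ 0 ∧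
      ∀ σ s, f (spechtRepOf F h σ s) = ρ σ (f s) := by
  classical
  obtain ⟨v, hv⟩ := exists_ne (0 : V)
  -- the span of an orbit is a finite-dimensional subrepresentation
  let U : Subrepresentation ρ := ⟨Submodule.span F (Set.range fun σ => ρ σ v), by
    intro g w hw
    have hle : Submodule.span F (Set.range fun σ => ρ σ v) ≤
        (Submodule.span F (Set.range fun σ => ρ σ v)).comap (ρ g) := by
      refine Submodule.span_le.2 ?_
      rintro _ ⟨σ, rfl⟩
      exact Submodule.subset_span ⟨g * σ, by simp⟩
    exact hle hw⟩
  have hfin : FiniteDimensional F U.toSubmodule :=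
    FiniteDimensional.span_of_finite F (Set.finite_range _)
  have hvU : v ∈ U.toSubmodule := Submodule.subset_span ⟨1, by simp⟩
  have hnt : Nontrivial U.toSubmodule :=
    ⟨⟨v, hvU⟩, 0, fun h => hv (congrArg Subtype.val h)⟩
  obtain ⟨μ, f, hf⟩ : ∃ (μ : {μ : YoungDiagram // μ.card = m})
      (f : (spechtRepOf F μ.2).IntertwiningMap U.toRepresentation), f ≠ 0 := by
    by_contra! h
    have hzero : characterPairing U.toRepresentation = 0 := by
      refine LinearMap.ext_on (span_classCharacter_specht m) ?_
      rintro _ ⟨μ, rfl⟩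
      have : Subsingleton ((spechtRepOf F μ.2).IntertwiningMap U.toRepresentation) :=
        ⟨fun f g => by rw [h μ f, h μ g]⟩
      rw [characterPairing_classCharacter, finrank_intertwining_comm,
        Module.finrank_zero_of_subsingleton, Nat.cast_zero, mul_zero, LinearMap.zero_apply]
    -- the character of `U` would be orthogonal to itself
    have h₁ := characterPairing_classCharacter U.toRepresentation U.toRepresentation
    rw [hzero, LinearMap.zero_apply] at h₁
    exact mul_ne_zero (Nat.cast_ne_zero.2 Nat.card_pos.ne')
      (Nat.cast_ne_zero.2 (finrank_intertwining_self_ne_zero _)) h₁.symm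
  refine ⟨μ.1, μ.2, U.toSubmodule.subtype ∘ₗ f.toLinearMap, fun h => hf ?_, fun σ s => ?_⟩
  · refine Representation.IntertwiningMap.ext (LinearMap.ext fun s => Subtype.ext ?_)
    exact LinearMap.congr_fun h s
  · exact congrArg Subtype.val (Representation.IntertwiningMap.isIntertwining _ _ f σ s)

end Completeness

/-! ### Modules over a layer with an idempotent generator -/

open scoped TensorProduct

section LayerTheory

variable {F X G V : Type*} [Field F] [Ring X] [Algebra F X] [AddCommGroup V] [Module F V]
  {lo hi : TwoSidedIdeal X} {u : X} {e : G → X} {c : F}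

/-- The element `u` is, up to the unit `c`, an idempotent that generates `hi` modulo `lo`, and the
corner `u X u` is spanned modulo `lo` by the elements `u (e g)`. -/
structure IsLayerGenerator (lo hi : TwoSidedIdeal X) (u : X) (e : G → X) (c : F) : Prop where
  ne_zero : c ≠ 0
  sq : u * u = c • u
  mem : u ∈ hi
  le_sup : hi ≤ lo ⊔ TwoSidedIdeal.span {u}
  corner : ∀ y, u * y * u ∈
    Submodule.span F (Set.range fun g => u * e g) ⊔ lo.asIdeal.restrictScalars F

theorem mem_layer {r : LayerRing lo} : r ∈ layer lo hi ↔ ∃ y ∈ hi, LayerRing.mk lo y = r := by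
  rw [layer, Ideal.mem_map_iff_of_surjective _ (LayerRing.mk_surjective lo)]
  rfl

theorem IsLayerGenerator.mem_layerMul (hu : IsLayerGenerator lo hi u e c) :
    LayerRing.mk lo u ∈ layerMul lo hi u := by
  refine Submodule.mem_map.2 ⟨LayerRing.mk lo (c⁻¹ • u), mem_layer.2 ⟨_, ?_, rfl⟩, ?_⟩
  · rw [Algebra.smul_def]
    exact hi.mul_mem_left _ _ hu.mem
  · rw [LinearMap.toSpanSingleton_apply, smul_eq_mul, ← map_mul, smul_mul_assoc, hu.sq,
      inv_smul_smul₀ hu.ne_zero]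

section Modules

variable {Q : Type*} [AddCommGroup Q] [Module X Q]

theorem LayerRing.mk_smul [Module (LayerRing lo) Q] [IsScalarTower X (LayerRing lo) Q] (y : X)
    (q : Q) : LayerRing.mk lo y • q = y • q := by
  rw [← mul_one (LayerRing.mk lo y), ← LayerRing.smul_def, smul_assoc, one_smul]

theorem LayerRing.mk_eq_zero {y : X} : LayerRing.mk lo y = 0 ↔ y ∈ lo :=
  Ideal.Quotient.eq_zero_iff_mem

theorem smul_eq_zero_of_mem_lo [Module (LayerRing lo) Q] [IsScalarTower X (LayerRing lo) Q] {y : X}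
    (hy : y ∈ lo) (q : Q) : y • q = 0 := by
  rw [← LayerRing.mk_smul (lo := lo), LayerRing.mk_eq_zero.2 hy, zero_smul]

/-- A vector whose orbit is killed by `u` is killed by `hi`. -/
theorem IsLayerGenerator.smul_eq_zero (hu : IsLayerGenerator lo hi u e c)
    (hlo : ∀ y ∈ lo, ∀ q : Q, y • q = 0) {q : Q} (hq : ∀ z : X, u • z • q = 0) {y : X}
    (hy : y ∈ hi) : y • q = 0 := by
  let K : TwoSidedIdeal X := TwoSidedIdeal.mk' {y | ∀ z : X, y • z • q = 0}
    (fun z => zero_smul _ _)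
    (fun {a b} ha hb z => by rw [add_smul, ha, hb, add_zero])
    (fun {a} ha z => by rw [neg_smul, ha, neg_zero])
    (fun {a b} hb z => by rw [mul_smul, hb, smul_zero])
    (fun {a b} ha z => by rw [mul_smul, ← mul_smul b z, ha])
  have hK : ∀ y, y ∈ K ↔ ∀ z : X, y • z • q = 0 := fun y => TwoSidedIdeal.mem_mk' ..
  have hle : hi ≤ K := hu.le_sup.trans (sup_le (fun y hy => (hK y).2 fun z => hlo y hy _)
    (TwoSidedIdeal.span_le.2 (Set.singleton_subset_iff.2 ((hK u).2 hq))))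
  simpa using (hK y).1 (hle hy) 1

variable [Group G]

/-- A module generated by the image of an irreducible representation `V` that contains everything of the
form `u • w` has, apart from itself, only submodules annihilated by `u`. -/
theorem eq_top_or_smul_eq_zero [Module F Q] [IsScalarTower F X Q] {ρ : Representation F G V}
    (hV : ∀ U : Submodule F V, (∀ g, ∀ v ∈ U, ρ g v ∈ U) → U = ⊥ ∨ U = ⊤)
    {j : V →ₗ[F] Q} (hj : ∀ g v, j (ρ g v) = e g • j v)
    (hspan : Submodule.span X (Set.range j) = ⊤)
    (hcorner : ∀ (y : X) v, u • y • j v ∈ LinearMap.range j) (W : Submodule X Q) :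
    W = ⊤ ∨ ∀ w ∈ W, u • w = 0 := by
  -- everything of the form `u • w` lies in the image of `V`
  have hrange : ∀ w : Q, u • w ∈ LinearMap.range j := fun w => by
    have hw : w ∈ Submodule.span X (Set.range j) := hspan ▸ Submodule.mem_top
    have key : ∀ y : X, u • y • w ∈ LinearMap.range j := by
      induction hw using Submodule.span_induction with
      | mem w hw =>
        obtain ⟨v, rfl⟩ := hw
        exact fun y => hcorner y v
      | zero => exact fun y => by simp
      | add a b _ _ ha hb =>
        intro y
        rw [smul_add, smul_add]
        exact Submodule.add_mem _ (ha y) (hb y)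
      | smul z a _ ha =>
        intro y
        rw [smul_smul y z]
        exact ha _
    simpa using key 1
  rcases hV ((W.restrictScalars F).comap j) (fun g v hv => by
    change j (ρ g v) ∈ W
    rw [hj]
    exact W.smul_mem _ hv) with h | h
  · refine .inr fun w hw => ?_
    obtain ⟨v, hv⟩ := hrange w
    have hvW : v ∈ (W.restrictScalars F).comap j := by
      change j v ∈ W
      rw [hv]
      exact W.smul_mem _ hw
    rw [h, Submodule.mem_bot] at hvW
    rw [← hv, hvW, map_zero]
  · refine .inl (eq_top_iff.2 ?_)
    rw [← hspan, Submodule.span_le]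
    rintro _ ⟨v, rfl⟩
    have hv : v ∈ (W.restrictScalars F).comap j := h ▸ Submodule.mem_top
    exact hv

end Modules

variable [Group G] {he : ∀ g, u * e g = e g * u} {ρ : Representation F G V}

namespace LayerModule

/-- The class of `p ⊗ v` in the module `(hi / lo) u ⊗_G V`. -/
def mk (he : ∀ g, u * e g = e g * u) (ρ : Representation F G V) :
    (layerMul lo hi u ⊗[F] V) →ₗ[LayerRing lo] LayerModule lo hi he ρ :=
  Submodule.mkQ (balancing lo hi he ρ)

theorem mk_surjective : Function.Surjective (mk (lo := lo) (hi := hi) he ρ) :=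
  Submodule.mkQ_surjective _

theorem mk_right (p : layerMul lo hi u) (g : G) (v : V) :
    mk he ρ (layerRight he g p ⊗ₜ[F] v) = mk he ρ (p ⊗ₜ[F] ρ g v) := by
  rw [← sub_eq_zero, ← map_sub]
  exact (Submodule.Quotient.mk_eq_zero _).2 (Submodule.subset_span ⟨p, g, v, rfl⟩)

end LayerModule

namespace IsLayerGenerator

variable (he ρ) in
/-- The map `v ↦ u ⊗ v` into the module `(hi / lo) u ⊗_G V`. -/
def toLayerModule (hu : IsLayerGenerator lo hi u e c) : V →ₗ[F] LayerModule lo hi he ρ :=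
  (LayerModule.mk he ρ).restrictScalars F ∘ₗ
    TensorProduct.mk F (layerMul lo hi u) V ⟨LayerRing.mk lo u, hu.mem_layerMul⟩

theorem toLayerModule_apply (hu : IsLayerGenerator lo hi u e c) (v : V) :
    hu.toLayerModule he ρ v =
      LayerModule.mk he ρ ((⟨LayerRing.mk lo u, hu.mem_layerMul⟩ : layerMul lo hi u) ⊗ₜ[F] v) := rfl

theorem span_toLayerModule (hu : IsLayerGenerator lo hi u e c) :
    Submodule.span X (Set.range (hu.toLayerModule he ρ)) = ⊤ := by
  rw [eq_top_iff]
  rintro w -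
  obtain ⟨z, rfl⟩ := LayerModule.mk_surjective w
  induction z using TensorProduct.induction_on with
  | zero => rw [map_zero]; exact Submodule.zero_mem _
  | add a b ha hb => rw [map_add]; exact Submodule.add_mem _ ha hb
  | tmul p v =>
    obtain ⟨p, hp⟩ := p
    obtain ⟨r, hr, rfl⟩ := Submodule.mem_map.1 hp
    obtain ⟨y, hy, rfl⟩ := mem_layer.1 hr
    have h : LayerModule.mk he ρ ((⟨_, hp⟩ : layerMul lo hi u) ⊗ₜ[F] v) =
        y • hu.toLayerModule he ρ v := by
      rw [toLayerModule_apply, ← LayerRing.mk_smul (lo := lo), ← map_smul, TensorProduct.smul_tmul']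
      rfl
    rw [h]
    exact Submodule.smul_mem _ _ (Submodule.subset_span ⟨v, rfl⟩)

theorem toLayerModule_rep (hu : IsLayerGenerator lo hi u e c) (g : G) (v : V) :
    hu.toLayerModule he ρ (ρ g v) = e g • hu.toLayerModule he ρ v := by
  rw [toLayerModule_apply, toLayerModule_apply, ← LayerModule.mk_right,
    ← LayerRing.mk_smul (lo := lo), ← map_smul, TensorProduct.smul_tmul']
  congr 2
  refine Subtype.ext ?_
  change LayerRing.mk lo u * LayerRing.mk lo (e g) = LayerRing.mk lo (e g) * LayerRing.mk lo u
  rw [← map_mul, he, map_mul]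

theorem smul_toLayerModule (hu : IsLayerGenerator lo hi u e c) (v : V) :
    u • hu.toLayerModule he ρ v = c • hu.toLayerModule he ρ v := by
  have h : LayerRing.mk lo u • (⟨LayerRing.mk lo u, hu.mem_layerMul⟩ : layerMul lo hi u) =
      c • ⟨LayerRing.mk lo u, hu.mem_layerMul⟩ := by
    refine Subtype.ext ?_
    change LayerRing.mk lo u * LayerRing.mk lo u = c • LayerRing.mk lo u
    rw [← map_mul, hu.sq]
    rfl
  rw [toLayerModule_apply, ← LayerRing.mk_smul (lo := lo), ← map_smul, TensorProduct.smul_tmul', h,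
    ← TensorProduct.smul_tmul']
  rfl

/-- The corner acts through the group: `u` maps the module generated by `u ⊗ V` to `u ⊗ V`. -/
theorem smul_smul_toLayerModule_mem (hu : IsLayerGenerator lo hi u e c) (y : X) (v : V) :
    u • y • hu.toLayerModule he ρ v ∈ LinearMap.range (hu.toLayerModule he ρ) := by
  have h : u • y • hu.toLayerModule he ρ v = c⁻¹ • (u * y * u) • hu.toLayerModule he ρ v := by
    rw [mul_smul, smul_toLayerModule, mul_smul, smul_comm y c, smul_comm u c,
      inv_smul_smul₀ hu.ne_zero]
  rw [h]
  refine Submodule.smul_mem _ _ ?_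
  have hle : Submodule.span F (Set.range fun g => u * e g) ⊔ lo.asIdeal.restrictScalars F ≤
      (LinearMap.range (hu.toLayerModule he ρ)).comap
        ((LinearMap.toSpanSingleton X _ (hu.toLayerModule he ρ v)).restrictScalars F) := by
    refine sup_le (Submodule.span_le.2 ?_) fun y hy => ?_
    · rintro _ ⟨g, rfl⟩
      change (u * e g) • hu.toLayerModule he ρ v ∈ LinearMap.range (hu.toLayerModule he ρ)
      rw [mul_smul, ← toLayerModule_rep, smul_toLayerModule, ← map_smul]
      exact ⟨_, rfl⟩
    · change y • hu.toLayerModule he ρ v ∈ LinearMap.range (hu.toLayerModule he ρ)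
      rw [smul_eq_zero_of_mem_lo (lo := lo) hy]
      exact Submodule.zero_mem _
  exact hle (hu.corner y)

/-- The submodule `N` in terms of the action of `X`. -/
theorem mem_layerNull {w : LayerModule lo hi he ρ} :
    w ∈ layerNull lo hi he ρ ↔ ∀ y ∈ hi, y • w = 0 := by
  constructor
  · intro h y hy
    rw [← LayerRing.mk_smul (lo := lo)]
    exact h _ (mem_layer.2 ⟨y, hy, rfl⟩)
  · intro h r hr
    obtain ⟨y, hy, rfl⟩ := mem_layer.1 hr
    rw [LayerRing.mk_smul]
    exact h y hy

/-- Every proper submodule of `M = (hi / lo) u ⊗_G V` is contained in `N`. -/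
theorem le_layerNull (hu : IsLayerGenerator lo hi u e c)
    (hV : ∀ U : Submodule F V, (∀ g, ∀ v ∈ U, ρ g v ∈ U) → U = ⊥ ∨ U = ⊤)
    {W : Submodule X (LayerModule lo hi he ρ)} (hW : W ≠ ⊤) :
    W ≤ (layerNull lo hi he ρ).restrictScalars X := by
  intro w hw
  have h := (eq_top_or_smul_eq_zero hV hu.toLayerModule_rep hu.span_toLayerModule
    hu.smul_smul_toLayerModule_mem W).resolve_left hW
  exact mem_layerNull.2 fun y hy => hu.smul_eq_zero
    (fun y hy q => smul_eq_zero_of_mem_lo (lo := lo) hy q) (fun z => h _ (W.smul_mem z hw)) hy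

theorem toLayerModule_notMem (hu : IsLayerGenerator lo hi u e c) {v : V}
    (hv : hu.toLayerModule he ρ v ≠ 0) : hu.toLayerModule he ρ v ∉ layerNull lo hi he ρ := by
  intro h
  have h' := mem_layerNull.1 h u hu.mem
  rw [smul_toLayerModule] at h'
  exact hv ((_root_.smul_eq_zero.1 h').resolve_left hu.ne_zero)

theorem isCoatom_layerNull (hu : IsLayerGenerator lo hi u e c)
    (hV : ∀ U : Submodule F V, (∀ g, ∀ v ∈ U, ρ g v ∈ U) → U = ⊥ ∨ U = ⊤)
    (hne : hu.toLayerModule he ρ ≠ 0) :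
    IsCoatom ((layerNull lo hi he ρ).restrictScalars X) := by
  constructor
  · intro h
    obtain ⟨v, hv⟩ : ∃ v, hu.toLayerModule he ρ v ≠ 0 := by
      by_contra! h'
      exact hne (LinearMap.ext h')
    refine hu.toLayerModule_notMem hv ?_
    change _ ∈ (layerNull lo hi he ρ).restrictScalars X
    rw [h]
    exact Submodule.mem_top
  · intro W hW
    by_contra hne
    exact hW.not_ge (hu.le_layerNull hV hne)

theorem eq_layerNull_of_isCoatom (hu : IsLayerGenerator lo hi u e c)
    (hV : ∀ U : Submodule F V, (∀ g, ∀ v ∈ U, ρ g v ∈ U) → U = ⊥ ∨ U = ⊤)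
    (hne : hu.toLayerModule he ρ ≠ 0) {W : Submodule X (LayerModule lo hi he ρ)}
    (hW : IsCoatom W) : W = (layerNull lo hi he ρ).restrictScalars X :=
  ((hW.le_iff_eq (hu.isCoatom_layerNull hV hne).1).1 (hu.le_layerNull hV hW.1)).symm

theorem isSimpleModule_quotient (hu : IsLayerGenerator lo hi u e c)
    (hV : ∀ U : Submodule F V, (∀ g, ∀ v ∈ U, ρ g v ∈ U) → U = ⊥ ∨ U = ⊤)
    (hne : hu.toLayerModule he ρ ≠ 0) :
    IsSimpleModule X (LayerModule lo hi he ρ ⧸ layerNull lo hi he ρ) := by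
  have := isSimpleModule_iff_isCoatom.2 (hu.isCoatom_layerNull hV hne)
  exact IsSimpleModule.congr
    (Submodule.Quotient.restrictScalarsEquiv X (layerNull lo hi he ρ)).symm

theorem isSimpleModule_iff (hu : IsLayerGenerator lo hi u e c)
    (hV : ∀ U : Submodule F V, (∀ g, ∀ v ∈ U, ρ g v ∈ U) → U = ⊥ ∨ U = ⊤)
    (hne : hu.toLayerModule he ρ ≠ 0) :
    IsSimpleModule X (LayerModule lo hi he ρ) ↔ layerNull lo hi he ρ = ⊥ := by
  have hco := hu.isCoatom_layerNull hV hne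
  rw [← Submodule.restrictScalars_eq_bot_iff (S := X)]
  constructor
  · intro h
    exact (eq_bot_or_eq_top _).resolve_right hco.1
  · intro h
    rw [h] at hco
    exact (_root_.isSimpleModule_iff _ _).2 (isSimpleOrder_iff_isCoatom_bot.2 hco)

/-- The quotient `M / N` is irreducible already under the layer, which has no unit in general. -/
theorem layerIrreducible_quotient (hu : IsLayerGenerator lo hi u e c)
    (hV : ∀ U : Submodule F V, (∀ g, ∀ v ∈ U, ρ g v ∈ U) → U = ⊥ ∨ U = ⊤)
    (hne : hu.toLayerModule he ρ ≠ 0) :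
    LayerIrreducible F lo hi (LayerModule lo hi he ρ ⧸ layerNull lo hi he ρ) := by
  constructor
  · obtain ⟨v, hv⟩ : ∃ v, hu.toLayerModule he ρ v ≠ 0 := by
      by_contra! h'
      exact hne (LinearMap.ext h')
    refine ⟨LayerRing.mk lo u, mem_layer.2 ⟨u, hu.mem, rfl⟩,
      Submodule.Quotient.mk (hu.toLayerModule he ρ v), fun h => ?_⟩
    rw [← Submodule.Quotient.mk_smul, Submodule.Quotient.mk_eq_zero, LayerRing.mk_smul,
      smul_toLayerModule, ← map_smul] at h
    refine hu.toLayerModule_notMem ?_ h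
    rw [map_smul]
    exact smul_ne_zero hu.ne_zero hv
  · intro W hW
    have hsmul : ∀ y ∈ hi, ∀ w : LayerModule lo hi he ρ,
        (Submodule.Quotient.mk w : LayerModule lo hi he ρ ⧸ layerNull lo hi he ρ) ∈ W →
        (Submodule.Quotient.mk (y • w) : LayerModule lo hi he ρ ⧸ layerNull lo hi he ρ) ∈ W := by
      intro y hy w hw
      rw [← LayerRing.mk_smul (lo := lo), Submodule.Quotient.mk_smul]
      exact hW _ (mem_layer.2 ⟨y, hy, rfl⟩) _ hw
    -- `W` is only a subspace invariant under the layer; the layer applied to its preimage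
    -- generates an `X`-submodule `Y` of `M`, which is all of `M` or lies in `N`
    let Y : Submodule X (LayerModule lo hi he ρ) := Submodule.span X
      {z | ∃ y ∈ hi, ∃ w : LayerModule lo hi he ρ,
        (Submodule.Quotient.mk w : LayerModule lo hi he ρ ⧸ layerNull lo hi he ρ) ∈ W ∧ z = y • w}
    by_cases hY : Y = ⊤
    · right
      rw [eq_top_iff]
      rintro q -
      obtain ⟨w, rfl⟩ := Submodule.Quotient.mk_surjective _ q
      have hw : w ∈ Y := hY ▸ Submodule.mem_top
      have key : ∀ y : X,
          (Submodule.Quotient.mk (y • w) : LayerModule lo hi he ρ ⧸ layerNull lo hi he ρ) ∈ W := by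
        induction hw using Submodule.span_induction with
        | mem z hz =>
          obtain ⟨y, hy, w, hw, rfl⟩ := hz
          intro z
          rw [smul_smul]
          exact hsmul _ (hi.mul_mem_left _ _ hy) _ hw
        | zero => exact fun y => by simp
        | add a b _ _ ha hb =>
          intro y
          rw [smul_add]
          exact W.add_mem (ha y) (hb y)
        | smul z a _ ha =>
          intro y
          rw [smul_smul]
          exact ha _
      simpa using key 1
    · left
      have hYN := hu.le_layerNull hV hY
      rw [eq_bot_iff]
      intro q hq
      obtain ⟨w, rfl⟩ := Submodule.Quotient.mk_surjective _ q
      rw [Submodule.mem_bot, Submodule.Quotient.mk_eq_zero, mem_layerNull]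
      refine fun y hy => hu.smul_eq_zero
        (fun y hy q => smul_eq_zero_of_mem_lo (lo := lo) hy q) (fun z => ?_) hy
      have h₁ : (u * z) • w ∈ layerNull lo hi he ρ :=
        hYN (Submodule.subset_span ⟨u * z, hi.mul_mem_right _ _ hu.mem, w, hq, rfl⟩)
      have h₂ := mem_layerNull.1 h₁ u hu.mem
      rw [smul_smul, ← mul_assoc, hu.sq, smul_mul_assoc, smul_assoc, mul_smul] at h₂
      exact (_root_.smul_eq_zero.1 h₂).resolve_left hu.ne_zero

/-- The map `v ↦ u ⊗ v` is injective if some linear map from `X` to the endomorphisms of `V` vanishes on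
`lo`, is compatible with the right action and sends `u` to the identity: it induces a left inverse. -/
theorem toLayerModule_injective (hu : IsLayerGenerator lo hi u e c) (ψ : X →ₗ[F] V →ₗ[F] V)
    (hlo : ∀ y ∈ lo, ψ y = 0) (hψ : ∀ y g v, ψ (y * e g) v = ψ y (ρ g v)) (h1 : ∀ v, ψ u v = v) :
    Function.Injective (hu.toLayerModule he ρ) := by
  let ψ' : LayerRing lo →ₗ[F] V →ₗ[F] V :=
    (Submodule.liftQ (lo.asIdeal.restrictScalars F) ψ hlo).comp
      (Submodule.Quotient.restrictScalarsEquiv F lo.asIdeal).symm.toLinearMap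
  have hψ' : ∀ y, ψ' (LayerRing.mk lo y) = ψ y := fun y => rfl
  let Φ : (layerMul lo hi u ⊗[F] V) →ₗ[F] V :=
    TensorProduct.lift (ψ' ∘ₗ ((layerMul lo hi u).restrictScalars F).subtype)
  have hΦ : ∀ (p : layerMul lo hi u) (v : V), Φ (p ⊗ₜ v) = ψ' p.1 v := fun p v => rfl
  have hz : ∀ z ∈ balancing lo hi he ρ, ∀ r : LayerRing lo, Φ (r • z) = 0 := by
    intro z hz
    induction hz using Submodule.span_induction with
    | mem z hz =>
      obtain ⟨p, g, v, rfl⟩ := hz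
      intro r
      rw [smul_sub, TensorProduct.smul_tmul', TensorProduct.smul_tmul', map_sub, hΦ, hΦ, sub_eq_zero]
      change ψ' (r * (p.1 * LayerRing.mk lo (e g))) v = ψ' (r * p.1) (ρ g v)
      rw [← mul_assoc]
      obtain ⟨y, hy⟩ := LayerRing.mk_surjective lo (r * p.1)
      rw [← hy, ← map_mul, hψ', hψ', hψ]
    | zero => simp
    | add a b _ _ ha hb => intro r; rw [smul_add, map_add, ha, hb, add_zero]
    | smul s a _ ha => intro r; rw [smul_smul]; exact ha _
  rw [injective_iff_map_eq_zero]
  intro v hv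
  have h := hz _ ((Submodule.Quotient.mk_eq_zero _).1 hv) 1
  rw [one_smul] at h
  have h' := (hΦ _ v).symm.trans h
  rwa [hψ', h1] at h'

section Lift

variable {Q : Type*} [AddCommGroup Q] [Module X Q] [Module F Q] [Module (LayerRing lo) Q]
  [IsScalarTower X (LayerRing lo) Q] [IsScalarTower F (LayerRing lo) Q]

/-- An equivariant map from `V` to a module over `X / lo` extends to `(hi / lo) u ⊗_G V`. -/
theorem exists_lift (hu : IsLayerGenerator lo hi u e c) {f : V →ₗ[F] Q}
    (hf : ∀ g v, f (ρ g v) = e g • f v) :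
    ∃ θ : LayerModule lo hi he ρ →ₗ[X] Q, ∀ v, θ (hu.toLayerModule he ρ v) = u • f v := by
  let B : layerMul lo hi u →ₗ[LayerRing lo] V →ₗ[F] Q :=
    { toFun := fun p =>
        { toFun := fun v => p.1 • f v
          map_add' := fun v w => by rw [map_add, smul_add]
          map_smul' := fun a v => by rw [map_smul, RingHom.id_apply, smul_algebra_smul_comm] }
      map_add' := fun p q => LinearMap.ext fun v => add_smul _ _ _
      map_smul' := fun r p => LinearMap.ext fun v => mul_smul _ _ _ }
  let Φ : (layerMul lo hi u ⊗[F] V) →ₗ[LayerRing lo] Q := TensorProduct.AlgebraTensorModule.lift B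
  have hΦ : ∀ (p : layerMul lo hi u) (v : V), Φ (p ⊗ₜ v) = p.1 • f v := fun p v => rfl
  have hle : balancing lo hi he ρ ≤ LinearMap.ker Φ := by
    refine Submodule.span_le.2 ?_
    rintro _ ⟨p, g, v, rfl⟩
    rw [SetLike.mem_coe, LinearMap.mem_ker, map_sub, hΦ, hΦ, sub_eq_zero, hf,
      ← LayerRing.mk_smul (lo := lo), smul_smul]
    rfl
  let θ : LayerModule lo hi he ρ →ₗ[LayerRing lo] Q := Submodule.liftQ _ Φ hle
  refine ⟨θ.restrictScalars X, fun v => ?_⟩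
  rw [← LayerRing.mk_smul (lo := lo)]
  rfl

end Lift

end IsLayerGenerator

end LayerTheory

/-! ### The layers of the diagram algebras -/

section XAlgebra

variable {F : Type*} [Field F] {k : Kind} {n : ℕ} {x : F}

namespace XAlg

theorem of_congr {a b : Diagram n} (h : a = b) (ha : a ∈ k.diagrams n) (hb : b ∈ k.diagrams n) :
    of F x a ha = of F x b hb := by
  subst h; rfl

theorem of_mul_of {a b : Diagram n} (ha : a ∈ k.diagrams n) (hb : b ∈ k.diagrams n) :
    of F x a ha * of F x b hb = x ^ a.loops b • of F x (a.comp b) (k.comp_mem ha hb) :=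
  Subtype.ext (AAlg.of_mul_of a b)

theorem of_one : of F x (.ofPerm 1) (k.noHorizontal_mem (Diagram.noHorizontal_ofPerm 1)) =
    (1 : XAlg F k n x) := Subtype.ext rfl

/-- The inclusion of `𝕏_n` in `𝔸_n`. -/
noncomputable def incl : XAlg F k n x →ₗ[F] AAlg F n x where
  toFun y := y.1
  map_add' _ _ := rfl
  map_smul' _ _ := rfl

/-- The algebra `𝕏_n` is spanned by its diagrams. -/
theorem span_of : Submodule.span F
    (Set.range fun d : k.diagrams n => of F x d.1 d.2) = ⊤ := by
  refine Submodule.map_injective_of_injective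
    (f := incl) Subtype.val_injective ?_
  rw [Submodule.map_span, ← Set.range_comp, Submodule.map_top]
  have h₁ : (Set.range fun d : k.diagrams n => AAlg.of x d.1) = AAlg.of x '' k.diagrams n := by
    rw [Set.image_eq_range]
  refine (congrArg _ h₁).trans ?_
  exact (Submodule.range_subtype (Submodule.span F (AAlg.of x '' k.diagrams n))).symm

/-- The coefficient of a diagram. -/
noncomputable def coeff (d : Diagram n) : XAlg F k n x →ₗ[F] F :=
  (Finsupp.lapply d : (Diagram n →₀ F) →ₗ[F] F) ∘ₗ (incl : XAlg F k n x →ₗ[F] AAlg F n x)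

open Classical in
theorem coeff_of (d b : Diagram n) (hb : b ∈ k.diagrams n) :
    coeff d (of F x b hb) = if b = d then 1 else 0 :=
  Finsupp.single_apply

end XAlg

/-- The ideal generated by the diagrams with fewer than `m` vertical arcs is spanned by them, as the
number of vertical arcs of a product is at most that of each factor. -/
theorem mem_span_of_mem_below {m : ℕ} {y : XAlg F k n x} (hy : y ∈ below F k n x m) :
    y ∈ Submodule.span F {z | ∃ (d : Diagram n) (hd : d ∈ k.diagrams n),
      d.verticals < m ∧ z = XAlg.of F x d hd} := by
  set S := Submodule.span F {z | ∃ (d : Diagram n) (hd : d ∈ k.diagrams n),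
      d.verticals < m ∧ z = XAlg.of F x d hd} with hS
  have hl : ∀ {a b}, b ∈ S → a * b ∈ S := by
    intro a b hb
    have h := Submodule.mul_mem_mul (Submodule.mem_top (R := F) (x := a)) hb
    rw [← XAlg.span_of, hS, Submodule.span_mul_span] at h
    refine Submodule.span_le.2 ?_ h
    rintro _ ⟨_, ⟨d, rfl⟩, _, ⟨d', hd', hv, rfl⟩, rfl⟩
    simp only [XAlg.of_mul_of]
    exact Submodule.smul_mem _ _ (Submodule.subset_span
      ⟨_, _, (Diagram.verticals_comp_le_right _ _).trans_lt hv, rfl⟩)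
  have hr : ∀ {a b}, a ∈ S → a * b ∈ S := by
    intro a b ha
    have h := Submodule.mul_mem_mul ha (Submodule.mem_top (R := F) (x := b))
    rw [← XAlg.span_of, hS, Submodule.span_mul_span] at h
    refine Submodule.span_le.2 ?_ h
    rintro _ ⟨_, ⟨d', hd', hv, rfl⟩, _, ⟨d, rfl⟩, rfl⟩
    simp only [XAlg.of_mul_of]
    exact Submodule.smul_mem _ _ (Submodule.subset_span
      ⟨_, _, (Diagram.verticals_comp_le_left _ _).trans_lt hv, rfl⟩)
  let K : TwoSidedIdeal (XAlg F k n x) := TwoSidedIdeal.mk' S S.zero_mem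
    (fun ha hb => S.add_mem ha hb) (fun ha => S.neg_mem ha) hl hr
  have hK : ∀ y, y ∈ K ↔ y ∈ S := fun y => TwoSidedIdeal.mem_mk' ..
  have hle : below F k n x m ≤ K :=
    TwoSidedIdeal.span_le.2 fun y hy => (hK y).2 (Submodule.subset_span hy)
  exact (hK y).1 (hle hy)

/-- Diagrams with at least `m` vertical arcs do not occur in the ideal generated by those with
fewer. -/
theorem coeff_eq_zero_of_mem_below {m : ℕ} {y : XAlg F k n x} (hy : y ∈ below F k n x m)
    {d : Diagram n} (hd : m ≤ d.verticals) : XAlg.coeff d y = 0 := by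
  have hle : Submodule.span F {z | ∃ (d : Diagram n) (hd : d ∈ k.diagrams n),
      d.verticals < m ∧ z = XAlg.of F x d hd} ≤ LinearMap.ker (XAlg.coeff d) := by
    refine Submodule.span_le.2 ?_
    rintro _ ⟨b, hb, hv, rfl⟩
    rw [SetLike.mem_coe, LinearMap.mem_ker, XAlg.coeff_of, if_neg]
    rintro rfl
    exact hv.not_ge hd
  exact hle (mem_span_of_mem_below hy)

theorem of_mem_below {m : ℕ} {d : Diagram n} (hd : d ∈ k.diagrams n) (h : d.verticals < m) :
    XAlg.of F x d hd ∈ below F k n x m :=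
  TwoSidedIdeal.subset_span ⟨d, hd, h, rfl⟩

theorem smul_mem_twoSidedIdeal {I : TwoSidedIdeal (XAlg F k n x)} (a : F) {y : XAlg F k n x}
    (hy : y ∈ I) : a • y ∈ I := by
  rw [Algebra.smul_def]
  exact I.mul_mem_left _ _ hy

variable {m : ℕ}

variable (F k x) in
/-- The element `𝔲` of `𝕏_n` with `m` vertical arcs. -/
noncomputable def idemElt (n m : ℕ) : XAlg F k n x :=
  XAlg.of F x (.idem n m) (k.noHorizontal_mem (Diagram.noHorizontal_idem m))

variable (F k x) in
/-- The embedding of the symmetric group of degree `m` into `𝕏_n`. -/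
noncomputable def permElt (h : m ≤ n) : Equiv.Perm (Fin m) →* XAlg F k n x where
  toFun σ := XAlg.of F x (.smallPerm h σ) (k.noHorizontal_mem (Diagram.noHorizontal_ofPerm _))
  map_one' := (XAlg.of_congr (Diagram.smallPerm_one h) _ _).trans XAlg.of_one
  map_mul' σ τ := by
    rw [XAlg.of_mul_of, XAlg.of_congr (Diagram.smallPerm_mul h σ τ) _ (k.comp_mem
      (k.noHorizontal_mem (Diagram.noHorizontal_ofPerm _))
      (k.noHorizontal_mem (Diagram.noHorizontal_ofPerm _))),
      show (Diagram.smallPerm h σ).loops (Diagram.smallPerm h τ) = 0 from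
        (Diagram.comp_ofPerm _ _).2, pow_zero, one_smul]

theorem of_mul_permElt (h : m ≤ n) {d : Diagram n} (hd : d ∈ k.diagrams n)
    (σ : Equiv.Perm (Fin m)) : XAlg.of F x d hd * permElt F k x h σ =
      XAlg.of F x (d.comp (.smallPerm h σ))
        (k.comp_mem hd (k.noHorizontal_mem (Diagram.noHorizontal_ofPerm _))) := by
  refine (XAlg.of_mul_of (b := .smallPerm h σ) hd
    (k.noHorizontal_mem (Diagram.noHorizontal_ofPerm _))).trans ?_
  rw [show d.loops (Diagram.smallPerm h σ) = 0 from (Diagram.comp_ofPerm _ _).2, pow_zero, one_smul]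

/-- Each layer of `𝕏_n` is generated by its element `𝔲`, whose corner is the group algebra of a symmetric
group. -/
theorem isLayerGenerator_idemElt (hx : x ≠ 0) (h : m ≤ n) :
    IsLayerGenerator (below F k n x m) (below F k n x (m + 1)) (idemElt F k x n m)
      (permElt F k x h) (x ^ (Diagram.idem n m).loops (Diagram.idem n m)) where
  ne_zero := pow_ne_zero _ hx
  sq := by
    refine (XAlg.of_mul_of _ _).trans (congrArg _ ?_)
    exact XAlg.of_congr Diagram.idem_comp_idem _ _
  mem := of_mem_below _ (by rw [Diagram.verticals_idem h]; exact m.lt_succ_self)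
  le_sup := by
    refine TwoSidedIdeal.span_le.2 ?_
    rintro _ ⟨d, hd, hv, rfl⟩
    rcases Nat.lt_succ_iff_lt_or_eq.1 hv with hv | hv
    · exact (le_sup_left : below F k n x m ≤ _) (of_mem_below hd hv)
    -- `a 𝔲 b` is `d` times a power of `x`, which is invertible
    refine (le_sup_right : TwoSidedIdeal.span {idemElt F k x n m} ≤ _) ?_
    obtain ⟨a, ha, b, hb, e⟩ := Diagram.exists_factor hd
    rw [hv] at e
    have hi := k.noHorizontal_mem (n := n) (Diagram.noHorizontal_idem m)
    have hmul : XAlg.of F x a ha * idemElt F k x n m * XAlg.of F x b hb =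
        (x ^ a.loops (.idem n m) * x ^ (a.comp (.idem n m)).loops b) • XAlg.of F x d hd := by
      rw [idemElt, XAlg.of_mul_of, smul_mul_assoc, XAlg.of_mul_of, smul_smul,
        XAlg.of_congr e hd (k.comp_mem (k.comp_mem ha hi) hb)]
    have hne : x ^ a.loops (.idem n m) * x ^ (a.comp (.idem n m)).loops b ≠ 0 :=
      mul_ne_zero (pow_ne_zero _ hx) (pow_ne_zero _ hx)
    rw [← inv_smul_smul₀ hne (XAlg.of F x d hd), ← hmul]
    exact smul_mem_twoSidedIdeal _ (TwoSidedIdeal.mul_mem_right _ _ _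
      (TwoSidedIdeal.mul_mem_left _ _ _ (TwoSidedIdeal.subset_span rfl)))
  corner := by
    intro y
    set T := Submodule.span F (Set.range fun σ => idemElt F k x n m * permElt F k x h σ) ⊔
      (below F k n x m).asIdeal.restrictScalars F with hT
    have hle : Submodule.span F (Set.range fun d : k.diagrams n => XAlg.of F x d.1 d.2) ≤
        T.comap (LinearMap.mulRight F (idemElt F k x n m) ∘ₗ
          LinearMap.mulLeft F (idemElt F k x n m)) := by
      refine Submodule.span_le.2 ?_
      rintro _ ⟨⟨d, hd⟩, rfl⟩
      change idemElt F k x n m * XAlg.of F x d hd * idemElt F k x n m ∈ T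
      rw [idemElt, XAlg.of_mul_of, smul_mul_assoc, XAlg.of_mul_of, smul_smul]
      refine T.smul_mem _ ?_
      rcases Diagram.idem_comp_comp_idem_cases h d with hv | ⟨σ, e⟩
      · exact (le_sup_right : (below F k n x m).asIdeal.restrictScalars F ≤ T)
          (of_mem_below _ hv)
      · refine (le_sup_left : Submodule.span F
          (Set.range fun σ => idemElt F k x n m * permElt F k x h σ) ≤ T) (Submodule.subset_span ⟨σ, ?_⟩)
        exact (of_mul_permElt h _ σ).trans (XAlg.of_congr e.symm _ _)
    exact hle (by rw [XAlg.span_of]; exact Submodule.mem_top)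

theorem le_verticals_idem_comp_smallPerm (h : m ≤ n) (σ : Equiv.Perm (Fin m)) :
    m ≤ ((Diagram.idem n m).comp (.smallPerm h σ)).verticals := by
  have e : ((Diagram.idem n m).comp (.smallPerm h σ)).comp (.smallPerm h σ⁻¹) =
      Diagram.idem n m := by
    rw [Diagram.comp_assoc, ← Diagram.smallPerm_mul, mul_inv_cancel, Diagram.smallPerm_one,
      Diagram.comp_ofPerm_one]
  have := Diagram.verticals_comp_le_left ((Diagram.idem n m).comp (.smallPerm h σ))
    (.smallPerm h σ⁻¹)
  rwa [e, Diagram.verticals_idem h] at this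

section Detect

variable {V : Type*} [AddCommGroup V] [Module F V]

/-- The action on `V` of the part of `y ∈ 𝕏_n` supported on the diagrams `𝔲 σ`. -/
noncomputable def cornerAction (k : Kind) (x : F) (h : m ≤ n)
    (ρ : Representation F (Equiv.Perm (Fin m)) V) : XAlg F k n x →ₗ[F] V →ₗ[F] V :=
  ∑ σ, (LinearMap.toSpanSingleton F (V →ₗ[F] V) (ρ σ)) ∘ₗ
    XAlg.coeff ((Diagram.idem n m).comp (.smallPerm h σ))

theorem cornerAction_apply (h : m ≤ n) (ρ : Representation F (Equiv.Perm (Fin m)) V)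
    (y : XAlg F k n x) (v : V) : cornerAction k x h ρ y v =
      ∑ σ, XAlg.coeff ((Diagram.idem n m).comp (.smallPerm h σ)) y • ρ σ v := by
  simp [cornerAction, LinearMap.sum_apply]

theorem cornerAction_mul_permElt (h : m ≤ n) (ρ : Representation F (Equiv.Perm (Fin m)) V)
    (y : XAlg F k n x) (τ : Equiv.Perm (Fin m)) (v : V) :
    cornerAction k x h ρ (y * permElt F k x h τ) v = cornerAction k x h ρ y (ρ τ v) := by
  classical
  have key : (LinearMap.applyₗ v ∘ₗ cornerAction k x h ρ) ∘ₗ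
      LinearMap.mulRight F (permElt F k x h τ) =
      LinearMap.applyₗ (ρ τ v) ∘ₗ cornerAction k x h ρ := by
    refine LinearMap.ext_on XAlg.span_of ?_
    rintro _ ⟨⟨d, hd⟩, rfl⟩
    change cornerAction k x h ρ (XAlg.of F x d hd * permElt F k x h τ) v =
      cornerAction k x h ρ (XAlg.of F x d hd) (ρ τ v)
    rw [of_mul_permElt, cornerAction_apply, cornerAction_apply]
    symm
    refine Fintype.sum_equiv (Equiv.mulRight τ) _ _ fun σ => ?_
    rw [XAlg.coeff_of, XAlg.coeff_of, Equiv.coe_mulRight, map_mul, Module.End.mul_apply]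
    congr 1
    refine if_congr ?_ rfl rfl
    rw [Diagram.smallPerm_mul, ← Diagram.comp_assoc]
    constructor
    · rintro rfl; rfl
    · intro e
      have e' := congrArg (fun a => Diagram.comp a (.smallPerm h τ⁻¹)) e
      simpa only [Diagram.comp_assoc, ← Diagram.smallPerm_mul, mul_inv_cancel_right,
        mul_inv_cancel, Diagram.smallPerm_one, Diagram.comp_ofPerm_one] using e'
  exact LinearMap.congr_fun key y

theorem cornerAction_idemElt (h : m ≤ n) (ρ : Representation F (Equiv.Perm (Fin m)) V) (v : V) :
    cornerAction k x h ρ (idemElt F k x n m) v = v := by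
  classical
  have h1 : (Diagram.idem n m).comp (.smallPerm h 1) = Diagram.idem n m := by
    rw [Diagram.smallPerm_one, Diagram.comp_ofPerm_one]
  rw [cornerAction_apply, Finset.sum_eq_single 1]
  · rw [idemElt, XAlg.coeff_of, if_pos h1.symm, one_smul, map_one, Module.End.one_apply]
  · intro σ _ hσ
    rw [idemElt, XAlg.coeff_of, if_neg, zero_smul]
    intro e
    exact hσ (Diagram.idem_comp_smallPerm_injective h (e.symm.trans h1.symm))
  · simp

end Detect

/-- The module `M` is not killed by `𝔲`: the part of an element of `𝕏_n` supported on the diagrams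
`𝔲 σ` depends only on its class modulo lower layers, and recovers `v` from `𝔲 ⊗ v`. -/
theorem toLayerModule_ne_zero {V : Type*} [AddCommGroup V] [Module F V] [Nontrivial V]
    (hx : x ≠ 0) (h : m ≤ n) (ρ : Representation F (Equiv.Perm (Fin m)) V)
    (he : ∀ σ, idemElt F k x n m * permElt F k x h σ = permElt F k x h σ * idemElt F k x n m) :
    (isLayerGenerator_idemElt (k := k) hx h).toLayerModule he ρ ≠ 0 := by
  intro h0
  obtain ⟨v, hv⟩ := exists_ne (0 : V)
  refine hv ((isLayerGenerator_idemElt (k := k) hx h).toLayerModule_injective (he := he) (ρ := ρ)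
    (cornerAction k x h ρ) ?_ (cornerAction_mul_permElt h ρ) (cornerAction_idemElt h ρ) ?_)
  · intro y hy
    refine LinearMap.ext fun v => ?_
    rw [cornerAction_apply]
    refine Finset.sum_eq_zero fun σ _ => ?_
    rw [coeff_eq_zero_of_mem_below hy (le_verticals_idem_comp_smallPerm h σ), zero_smul]
  · rw [h0, LinearMap.zero_apply, LinearMap.zero_apply]

/-- The lowest layer that acts nontrivially. It exists because the identity has `n` vertical arcs.
-/
theorem exists_minimal_layer (V : Type*) [AddCommGroup V] [Module (XAlg F k n x) V] [Nontrivial V] :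
    ∃ m ≤ n, (∀ y ∈ below F k n x m, ∀ v : V, y • v = 0) ∧
      ∃ y ∈ below F k n x (m + 1), ∃ v : V, y • v ≠ 0 := by
  classical
  have hex : ∃ m, ∃ y ∈ below F k n x (m + 1), ∃ v : V, y • v ≠ 0 := by
    obtain ⟨v, hv⟩ := exists_ne (0 : V)
    refine ⟨n, 1, ?_, v, by rwa [one_smul]⟩
    rw [← XAlg.of_one]
    exact of_mem_below _ (Nat.lt_succ_of_le (Diagram.verticals_le _))
  have hle : Nat.find hex ≤ n := by
    refine Nat.find_min' hex ?_
    obtain ⟨v, hv⟩ := exists_ne (0 : V)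
    refine ⟨1, ?_, v, by rwa [one_smul]⟩
    rw [← XAlg.of_one]
    exact of_mem_below _ (Nat.lt_succ_of_le (Diagram.verticals_le _))
  refine ⟨Nat.find hex, hle, ?_, Nat.find_spec hex⟩
  rcases h : Nat.find hex with - | m
  · intro y hy v
    have : below F k n x 0 ≤ ⊥ := TwoSidedIdeal.span_le.2 fun y ⟨_, _, h, _⟩ => by omega
    rw [(TwoSidedIdeal.mem_bot _).1 (this hy), zero_smul]
  · have h' := Nat.find_min hex (m := m) (by omega)
    push Not at h'
    exact h'

/-- Every irreducible module `V` is a quotient `M(μ) / N(μ)`: on the lowest layer that does not kill `V`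
the space `𝔲 V` is a nonzero representation of a symmetric group, hence receives a Specht module. -/
theorem exists_linearEquiv_quotient [CharZero F] (hx : x ≠ 0) (V : Type*) [AddCommGroup V]
    [Module (XAlg F k n x) V] [IsSimpleModule (XAlg F k n x) V] :
    ∃ (μ : YoungDiagram) (h : μ.card ≤ n),
      Nonempty (V ≃ₗ[XAlg F k n x] (MMod F k x h ⧸ NMod F k x h)) := by
  have : Nontrivial V := IsSimpleModule.nontrivial (XAlg F k n x) V
  obtain ⟨m, hm, hlo, y₀, hy₀, v₀, hv₀⟩ := exists_minimal_layer (F := F) (k := k) (n := n) (x := x) V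
  let _ : Module F V := Module.compHom V (algebraMap F (XAlg F k n x))
  have : IsScalarTower F (XAlg F k n x) V := ⟨fun a y v => by
    rw [Algebra.smul_def, mul_smul]
    rfl⟩
  -- lower layers act by zero, so `V` is a module over the quotient by them
  let _ : Module (LayerRing (below F k n x m)) V :=
    Module.IsTorsionBySet.module (I := (below F k n x m).asIdeal) fun v y => hlo y.1 y.2 v
  have hmk : ∀ (y : XAlg F k n x) (v : V), LayerRing.mk (below F k n x m) y • v = y • v :=
    fun _ _ => rfl
  have : IsScalarTower (XAlg F k n x) (LayerRing (below F k n x m)) V := ⟨fun y r v => by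
    obtain ⟨z, rfl⟩ := LayerRing.mk_surjective _ r
    rw [LayerRing.smul_def, ← map_mul, hmk, hmk, mul_smul]⟩
  have : IsScalarTower F (LayerRing (below F k n x m)) V := ⟨fun a r v => by
    obtain ⟨z, rfl⟩ := LayerRing.mk_surjective _ r
    change LayerRing.mk (below F k n x m) (a • z) • v = _
    rw [hmk, hmk, smul_assoc]⟩
  have hu := isLayerGenerator_idemElt (F := F) (k := k) hx hm
  set u := idemElt F k x n m with hu_def
  set c := x ^ (Diagram.idem n m).loops (Diagram.idem n m)
  let ρ : Representation F (Equiv.Perm (Fin m)) V :=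
    ((Algebra.lsmul F F V : XAlg F k n x →ₐ[F] _) : XAlg F k n x →* _).comp (permElt F k x hm)
  have hcomm : ∀ σ, u * permElt F k x hm σ = permElt F k x hm σ * u := idem_mul_smallPerm F k x hm
  let U : Subrepresentation ρ := ⟨LinearMap.range (Algebra.lsmul F F V u), by
    rintro σ _ ⟨v, rfl⟩
    refine ⟨permElt F k x hm σ • v, ?_⟩
    change u • permElt F k x hm σ • v = permElt F k x hm σ • u • v
    rw [smul_smul, hcomm, mul_smul]⟩
  have hU : ∀ w ∈ U.toSubmodule, u • w = c • w := by
    rintro _ ⟨v, rfl⟩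
    change u • u • v = c • u • v
    rw [smul_smul, hu.sq, smul_assoc]
  have hnt : Nontrivial U.toSubmodule := by
    obtain ⟨v, hv⟩ : ∃ v : V, u • v ≠ 0 := by
      by_contra! h0
      exact hv₀ (hu.smul_eq_zero hlo (fun z => h0 _) hy₀)
    exact ⟨⟨u • v, v, rfl⟩, 0, fun e => hv (congrArg Subtype.val e)⟩
  -- `ρ` restricts to `𝔲 V`, on which `𝔲` acts as the nonzero scalar `c`
  obtain ⟨μ, rfl, f, hf0, hf⟩ := exists_specht_hom U.toRepresentation
  obtain ⟨θ, hθ⟩ := hu.exists_lift (he := hcomm) (ρ := spechtRep F μ)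
    (f := U.toSubmodule.subtype ∘ₗ f) (fun σ s => by
      rw [← spechtRepOf_rfl]
      exact congrArg Subtype.val (hf σ s))
  have hθ0 : θ ≠ 0 := by
    rintro rfl
    refine hf0 (LinearMap.ext fun s => Subtype.ext ?_)
    have h1 : u • (f s : V) = 0 := (hθ s).symm
    rw [hU _ (f s).2] at h1
    exact (smul_eq_zero.1 h1).resolve_left hu.ne_zero
  have hsurj : Function.Surjective θ := LinearMap.surjective_of_ne_zero hθ0
  let E := θ.quotKerEquivOfSurjective hsurj
  have hker : IsCoatom (LinearMap.ker θ) := isSimpleModule_iff_isCoatom.1 (IsSimpleModule.congr E)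
  have heq := hu.eq_layerNull_of_isCoatom (fun U => Specht.eq_bot_or_eq_top)
    (toLayerModule_ne_zero hx hm (spechtRep F μ) hcomm) hker
  exact ⟨μ, hm, ⟨E.symm.trans ((Submodule.quotEquivOfEq _ _ heq).trans
    (Submodule.Quotient.restrictScalarsEquiv _ _))⟩⟩

end XAlgebra

end LoopBrauer

theorem propositionP {F : Type*} [Field F] [CharZero F] (x : F) (hx : x ≠ 0) (n : ℕ) (k : Kind) :
    (∀ (μ : YoungDiagram) (h : μ.card ≤ n),
      (IsSimpleModule (XAlg F k n x) (MMod F k x h ⧸ NMod F k x h) ∧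
        LayerIrreducible F (below F k n x μ.card) (below F k n x (μ.card + 1))
          (MMod F k x h ⧸ NMod F k x h) ∧
        (IsSimpleModule (XAlg F k n x) (MMod F k x h) ↔ NMod F k x h = ⊥)) ∧
      (IsCoatom ((NMod F k x h).restrictScalars (XAlg F k n x)) ∧
        ∀ N' : Submodule (XAlg F k n x) (MMod F k x h), IsCoatom N' →
          N' = (NMod F k x h).restrictScalars (XAlg F k n x))) ∧
    ∀ (V : Type*) [AddCommGroup V] [Module (XAlg F k n x) V], IsSimpleModule (XAlg F k n x) V →
      ∃ (μ : YoungDiagram) (h : μ.card ≤ n),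
        Nonempty (V ≃ₗ[XAlg F k n x] (MMod F k x h ⧸ NMod F k x h)) := by
  refine ⟨fun μ h => ?_, fun V _ _ _ => exists_linearEquiv_quotient hx V⟩
  have hu := isLayerGenerator_idemElt (F := F) (k := k) hx h
  have hV : ∀ U : Submodule F (Specht F μ), (∀ g, ∀ v ∈ U, spechtRep F μ g v ∈ U) →
      U = ⊥ ∨ U = ⊤ := fun U => Specht.eq_bot_or_eq_top
  have hne := toLayerModule_ne_zero hx h (spechtRep F μ) (idem_mul_smallPerm F k x h)
  exact ⟨⟨hu.isSimpleModule_quotient hV hne, hu.layerIrreducible_quotient hV hne,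
    hu.isSimpleModule_iff hV hne⟩, hu.isCoatom_layerNull hV hne,
    fun N' hN' => hu.eq_layerNull_of_isCoatom hV hne hN'⟩
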